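/- Let $\Sigma=\{0,1\}^{\mathbb N}$ carry the metric $\rho(s,t)=2^{-n}$, where $n$ is the length of the longest common prefix of $s\neq t$, let $\sigma$ be the left shift, $\Sigma_n=\{0,1\}^n$, $\Sigma_*=\bigcup_{n\ge 0}\Sigma_n$, let $t|_n$ be the prefix of length $n$ of $t$, let $[w]$ be the cylinder of a word $w$, and $\lambda(w)=\sum_{i=1}^{|w|}w_i2^{-i}$. For a nonempty closed set $X\subset\Sigma$ with $\sigma(X)\subset X$ and a Hölder continuous $\varphi:\Sigma\to\mathbb R$ let $$P_X(\varphi)=\lim_{n\to\infty}\frac1n\log\sum_{w\in\Sigma_n:\,[w]\cap X\neq\emptyset}\exp\Big(\max_{t\in[w]}\sum_{i=0}^{n-1}\varphi(\sigma^i t)\Big)$$ be the topological pressure of $\varphi$ on $X$. Let $\psi:\mathbb R\to\mathbb R$ be a function whose set of zeros $\mathcal Z=\{x\in[0,1]:\psi(x)=0\}$ is finite. For $x\in[0,1)$ let $x|_k$ be the word $w\in\Sigma_k$ with $\lambda(w)\le x<\lambda(w)+2^{-k}$, and let $1|_k=1\cdots1$. For $k\ge2$ let $\mathcal F_k=\bigcup_{x\in\mathcal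 Z}\mathcal F_k(x)$, where $\mathcal F_k(x)=\{x|_k\}$ if $x\notin\lambda(\Sigma_*)$ and $\mathcal F_k(x)=\{w\in\Sigma_k:0\le\lambda(x|_k)-\lambda(w)\le2^{-k}\}$ otherwise, and let $$Y_k=\{t\in\Sigma:\ \sigma^m(t)|_k\notin\mathcal F_k\ \ \forall m\ge0\}.$$ Consider the directed graph on $\Sigma_{k-1}$ with an edge from $a_1\cdots a_{k-1}$ to $a_2\cdots a_k$ for every $a_1\cdots a_k\in\Sigma_k\setminus\mathcal F_k$. The topologically transitive pieces of $Y_k$ are the sets $\{t\in Y_k:\sigma^m(t)|_{k-1}\in C\ \ \forall m\ge0\}$, where $C$ is an irreducible class of this graph, that is, the set of all vertices that are joined to and from some given vertex $u$ by paths of length at least $1$, where $u$ lies on a closed path of length at least $1$. Let $k_0\ge2$, and for each $k\ge k_0$ let $X_k$ be a topologically transitive piece of $Y_k$ with $\overline{\dim}_B X_k=\overline{\dim}_B Y_k$, where $\overline{\dim}_B$ is the upper box-counting dimension. Let $\varphi:\Sigma\to\mathbb R$ be Hölder continuous. Then the limits defining $P_\Sigma(q\varphi)$ and $P_{X_k}(q\varphi)$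 exist for all $q\in\mathbb R$ and $k\ge k_0$, these pressures are differentiable functions of $q\in\mathbb R$, and for every $q\in\mathbb R$ $$\lim_{k\to\infty}P_{X_k}(q\varphi)=P_\Sigma(q\varphi).$$ Moreover, on every compact interval of values of $q$, the functions $P_{X_k}(q\varphi)$ and $\frac{\mathrm d}{\mathrm dq}P_{X_k}(q\varphi)$ converge uniformly, as $k\to\infty$, to $P_\Sigma(q\varphi)$ and $\frac{\mathrm d}{\mathrm dq}P_\Sigma(q\varphi)$ respectively. -/

import Mathlib

open Filter Topology Set
open scoped NNReal ENNReal

namespace WaveletShift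

/-- The symbolic space `{0,1}^ℕ`; the letter `t_{i+1}` of the infinite word `t` is `t i`. -/
abbrev Seq : Type := ℕ → Fin 2

/-- Words of length `n`. -/
abbrev Word (n : ℕ) : Type := Fin n → Fin 2

/-- The standard metric: `ρ(s,t) = 2^{-n}`, with `n` the length of the longest common prefix of
`s ≠ t`. -/
noncomputable instance instMetricSpaceSeq : MetricSpace Seq := PiNat.metricSpace

/-- The left shift. -/
def shift (t : Seq) : Seq := fun i => t (i + 1)

/-- The prefix `t|_n`. -/
def pref (n : ℕ) (t : Seq) : Word n := fun i => t i

/-- The cylinder `[w]`. -/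
def cyl {n : ℕ} (w : Word n) : Set Seq := {t | pref n t = w}

/-- `λ(w) = ∑_{i=1}^{n} w_i 2^{-i}`. -/
noncomputable def lam {n : ℕ} (w : Word n) : ℝ :=
  ∑ i : Fin n, ((w i : ℕ) : ℝ) * (1 / 2) ^ ((i : ℕ) + 1)

/-- The sum over the words `w` of length `n` whose cylinder meets `X`, of
`exp (max_{t ∈ [w]} S_n φ (t))`. -/
noncomputable def partitionSum (X : Set Seq) (φ : Seq → ℝ) (n : ℕ) : ℝ :=
  open Classical in
  ∑ w : Word n with (cyl w ∩ X).Nonempty, Real.exp (sSup (birkhoffSum shift φ n '' cyl w))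

/-- The sequence whose limit is the topological pressure. -/
noncomputable def pressureSeq (X : Set Seq) (φ : Seq → ℝ) (n : ℕ) : ℝ :=
  (1 / (n : ℝ)) * Real.log (partitionSum X φ n)

/-- The topological pressure `P_X(φ)`. -/
noncomputable def pressure (X : Set Seq) (φ : Seq → ℝ) : ℝ :=
  limUnder atTop (pressureSeq X φ)

/-- The upper box-counting dimension: the limsup as `δ → 0+` of `log N_δ(X) / (-log δ)`, where
`N_δ(X)` is the least number of closed balls of radius `δ` centred in `X` that cover `X`. -/
noncomputable def upperBoxDim {E : Type*} [PseudoEMetricSpace E] (X : Set E) : EReal :=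
  limsup (fun δ : ℝ≥0 =>
    ENNReal.log (Metric.coveringNumber δ X : ℝ≥0∞) / ((-Real.log (δ : ℝ) : ℝ) : EReal)) (𝓝[>] 0)

/-- The subshift of finite type with admissible set `A` of words of length `n`. -/
def sft {n : ℕ} (A : Set (Word n)) : Set Seq := {t | ∀ m : ℕ, pref n (shift^[m] t) ∈ A}

/-- The transition relation on words of length `n - 1` induced by the admissible set `A`:
`a_1 ⋯ a_{n-1}` is followed by `a_2 ⋯ a_n` when `a_1 ⋯ a_n ∈ A`. -/
def Trans {n : ℕ} (A : Set (Word n)) (u v : Word (n - 1)) : Prop :=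
  ∃ a ∈ A, (∀ i : Fin (n - 1), u i = a ⟨i, by omega⟩) ∧
    (∀ i : Fin (n - 1), v i = a ⟨i + 1, by omega⟩)

/-- `X` is one of the topologically transitive pieces of `sft A`: the set of points all of whose
`(n-1)`-words lie in an irreducible class `C` of the transition relation, that is in the class of
all the words communicating (in at least one step) with a given word `u` that communicates with
itself. -/
def IsTransitivePiece {n : ℕ} (A : Set (Word n)) (X : Set Seq) : Prop :=
  ∃ (u : Word (n - 1)) (C : Set (Word (n - 1))),
    Relation.TransGen (Trans A) u u ∧
    C = {v | Relation.TransGen (Trans A) u v ∧ Relation.TransGen (Trans A) v u} ∧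
    X = {t ∈ sft A | ∀ m : ℕ, pref (n - 1) (shift^[m] t) ∈ C}

/-- `w = x|_k`: for `x ∈ [0,1)` the word with `λ(w) ≤ x < λ(w) + 2^{-k}`; for `x = 1` the word
`1⋯1`. -/
def IsDyadicPrefix {k : ℕ} (x : ℝ) (w : Word k) : Prop :=
  (x < 1 ∧ lam w ≤ x ∧ x < lam w + (1 / 2) ^ k) ∨ (x = 1 ∧ ∀ i, w i = 1)

/-- The set `λ(Σ_*)` of the values of `λ` on all finite words. -/
def lamRange : Set ℝ := {x | ∃ (n : ℕ) (w : Word n), lam w = x}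

/-- The words of length `k` forbidden by the point `x`: only `x|_k` if `x ∉ λ(Σ_*)`, and the words
`w` with `0 ≤ λ(x|_k) - λ(w) ≤ 2^{-k}` otherwise. -/
def forbiddenAt (k : ℕ) (x : ℝ) : Set (Word k) :=
  {w | ∃ v : Word k, IsDyadicPrefix x v ∧
    ((x ∉ lamRange ∧ w = v) ∨
      (x ∈ lamRange ∧ 0 ≤ lam v - lam w ∧ lam v - lam w ≤ (1 / 2) ^ k))}

/-- The zeros of `ψ` in `[0,1]`. -/
def zeros (ψ : ℝ → ℝ) : Set ℝ := {x | x ∈ Icc (0 : ℝ) 1 ∧ ψ x = 0}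

/-- The set of all words of length `k` that are not forbidden by a zero of `ψ`. -/
def admissible (ψ : ℝ → ℝ) (k : ℕ) : Set (Word k) := {w | ∀ x ∈ zeros ψ, w ∉ forbiddenAt k x}

/-- `X` is an admissible choice of the `k`-th zero-avoiding transitive subshift: a transitive piece
of the subshift of finite type avoiding the forbidden words of length `k`, of the same upper
box-counting dimension. -/
def IsZeroAvoidingPiece (ψ : ℝ → ℝ) (k : ℕ) (X : Set Seq) : Prop :=
  IsTransitivePiece (admissible ψ k) X ∧ upperBoxDim X = upperBoxDim (sft (admissible ψ k))

end WaveletShift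

/-!
On a one-sided transitive Markov subshift the iterates `L ^ n 1` of the transfer operator are
comparable with the partition sums, with constants that depend only on the bounds of the potential.
The partition sums are therefore multiplicative up to a constant, the pressure `P` exists, and
`L ^ n 1` is comparable with `exp (n * P)`.

As a function of `q` the pressure is convex. Suppose that it had left slope `β` and right slope
`α > β` at `q₀`. An elementary inequality bounds `exp s` by a constant, minus a multiple of
`exp (-t * s)`, plus a multiple of `exp (u * s)`; applied to `s = S / n - α`, where `S` is a
Birkhoff sum of length `n`, it bounds the operator with parameter `q₀ + 1 / n` by those with
parameters `q₀`, `q₀ - t / n` and `q₀ + u / n`. The left slope makes the subtracted term large and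
the right slope makes the last one small, so the pressure at `q₀ + 1 / n` is less than
`P q₀ + α / n`, contradicting the right slope `α`.

For the convergence, call a word of length `k / 2` safe if it occurs in no forbidden word of
length `k`. All concatenations of safe words avoid the forbidden words. Subexponentially many words
are not safe, so a piece of full dimension contains a safe word, and then all concatenations of safe
words. The other words carry at most half of the mass of the transfer operator of the full shift,
since the weight of a single word relative to the total decays exponentially, at a rate that is
uniform for bounded `q`. Hence the two pressures differ by `O(1 / k)`, and the derivatives converge
because the pressures are convex and the limit is differentiable.
-/

namespace WaveletShift

/-! ### Words and sequences -/

/-- The concatenation `w x` of a finite word `w` and a sequence `x`. -/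
def concat {n : ℕ} (w : Word n) (x : Seq) : Seq :=
  fun i => if h : i < n then w ⟨i, h⟩ else x (i - n)

theorem iterate_shift_apply (n : ℕ) (x : Seq) (i : ℕ) : shift^[n] x i = x (i + n) := by
  induction n generalizing x with
  | zero => rfl
  | succ n ih => rw [Function.iterate_succ_apply, ih, shift, add_assoc]

theorem pref_eq_pref_iff {n : ℕ} {x y : Seq} : pref n x = pref n y ↔ ∀ i < n, x i = y i :=
  funext_iff.trans Fin.forall_iff

theorem pref_eq_pref_of_le {m n : ℕ} {x y : Seq} (hmn : m ≤ n) (h : pref n x = pref n y) :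
    pref m x = pref m y :=
  pref_eq_pref_iff.2 fun i hi => pref_eq_pref_iff.1 h i (hi.trans_le hmn)

theorem pref_iterate_shift_eq {m n : ℕ} {x y : Seq} (h : pref (m + n) x = pref (m + n) y) :
    pref m (shift^[n] x) = pref m (shift^[n] y) := by
  refine pref_eq_pref_iff.2 fun i hi => ?_
  rw [iterate_shift_apply, iterate_shift_apply]
  exact pref_eq_pref_iff.1 h _ (by omega)

theorem iterate_shift_concat {n : ℕ} (w : Word n) (x : Seq) : shift^[n] (concat w x) = x := by
  funext i
  simp [iterate_shift_apply, concat]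

theorem pref_concat {n : ℕ} (w : Word n) (x : Seq) : pref n (concat w x) = w := by
  funext i
  simp [pref, concat]

theorem concat_pref_iterate_shift (n : ℕ) (x : Seq) : concat (pref n x) (shift^[n] x) = x := by
  funext i
  by_cases hi : i < n
  · simp [concat, hi, pref]
  · simp [concat, hi, iterate_shift_apply, Nat.sub_add_cancel (not_lt.1 hi)]

theorem concat_left_injective {n : ℕ} (x : Seq) :
    Function.Injective fun w : Word n => concat w x :=
  Function.LeftInverse.injective (g := pref n) fun w => pref_concat w x

theorem pref_add_concat_pref {m n : ℕ} {x y : Seq} (h : pref m (shift^[n] y) = pref m x) :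
    pref (n + m) (concat (pref n y) x) = pref (n + m) y := by
  refine pref_eq_pref_iff.2 fun i hi => ?_
  by_cases hin : i < n
  · simp [concat, hin, pref]
  · have := pref_eq_pref_iff.1 h (i - n) (by omega)
    rw [iterate_shift_apply, Nat.sub_add_cancel (not_lt.1 hin)] at this
    simp [concat, hin, this]

theorem iterate_shift_mem {X : Set Seq} (hX : ∀ x ∈ X, shift x ∈ X) (n : ℕ) {x : Seq}
    (hx : x ∈ X) : shift^[n] x ∈ X :=
  MapsTo.iterate (fun x hx => hX x hx) n hx

/-! ### Potentials with bounded distortion -/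

/-- Bowen's class of potentials: `g` is bounded by `C`, and its Birkhoff sums of length `n` vary by
at most `D` on cylinders of length `n`. Only the two constants enter the estimates below, which are
therefore uniform over such potentials. -/
structure IsBowen (g : Seq → ℝ) (C D : ℝ) : Prop where
  bound : ∀ x, |g x| ≤ C
  distortion : ∀ (n : ℕ) (x y : Seq), pref n x = pref n y →
    |birkhoffSum shift g n x - birkhoffSum shift g n y| ≤ D

namespace IsBowen

variable {g : Seq → ℝ} {C D : ℝ}

theorem bound_nonneg (hg : IsBowen g C D) : 0 ≤ C :=
  (abs_nonneg _).trans (hg.bound 0)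

theorem distortion_nonneg (hg : IsBowen g C D) : 0 ≤ D :=
  (abs_nonneg _).trans (hg.distortion 0 0 0 rfl)

theorem mono {C' D' : ℝ} (hg : IsBowen g C D) (hC : C ≤ C') (hD : D ≤ D') : IsBowen g C' D' :=
  ⟨fun x => (hg.bound x).trans hC, fun n x y h => (hg.distortion n x y h).trans hD⟩

theorem const_mul (hg : IsBowen g C D) (q : ℝ) :
    IsBowen (fun x => q * g x) (|q| * C) (|q| * D) where
  bound x := by
    rw [abs_mul]
    exact mul_le_mul_of_nonneg_left (hg.bound x) (abs_nonneg q)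
  distortion n x y h := by
    simp only [birkhoffSum, ← Finset.mul_sum, ← mul_sub, abs_mul]
    exact mul_le_mul_of_nonneg_left (hg.distortion n x y h) (abs_nonneg q)

theorem abs_birkhoffSum_le (hg : IsBowen g C D) (n : ℕ) (x : Seq) :
    |birkhoffSum shift g n x| ≤ n * C := by
  refine (Finset.abs_sum_le_sum_abs _ _).trans ((Finset.sum_le_sum fun i _ => hg.bound _).trans ?_)
  simp

theorem birkhoffSum_le_add (hg : IsBowen g C D) {n : ℕ} {x y : Seq} (h : pref n x = pref n y) :
    birkhoffSum shift g n x ≤ birkhoffSum shift g n y + D := by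
  linarith [le_of_abs_le (hg.distortion n x y h)]

end IsBowen

theorem isBowen_of_abs_sub_le_pow {g : Seq → ℝ} {C B θ : ℝ} (hC : ∀ x, |g x| ≤ C) (hθ0 : 0 ≤ θ)
    (hθ1 : θ < 1) (hB : ∀ (n : ℕ) (x y : Seq), pref n x = pref n y → |g x - g y| ≤ B * θ ^ n) :
    IsBowen g C (B / (1 - θ)) := by
  have hB0 : 0 ≤ B := by simpa using (abs_nonneg _).trans (hB 0 0 0 rfl)
  refine ⟨hC, fun n x y hxy => ?_⟩
  have hterm : ∀ i ∈ Finset.range n,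
      |g (shift^[i] x) - g (shift^[i] y)| ≤ B * θ ^ (n - 1 - i) := by
    intro i hi
    have hi' : n - 1 - i + 1 + i = n := by have := Finset.mem_range.1 hi; omega
    rw [← hi'] at hxy
    refine (hB _ _ _ (pref_iterate_shift_eq hxy)).trans ?_
    exact mul_le_mul_of_nonneg_left (pow_le_pow_of_le_one hθ0 hθ1.le (Nat.le_succ _)) hB0
  calc |birkhoffSum shift g n x - birkhoffSum shift g n y|
      ≤ ∑ i ∈ Finset.range n, |g (shift^[i] x) - g (shift^[i] y)| := by
        rw [birkhoffSum, birkhoffSum, ← Finset.sum_sub_distrib]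
        exact Finset.abs_sum_le_sum_abs _ _
    _ ≤ ∑ i ∈ Finset.range n, B * θ ^ (n - 1 - i) := Finset.sum_le_sum hterm
    _ = B * ∑ i ∈ Finset.range n, θ ^ i := by
        rw [← Finset.mul_sum, Finset.sum_range_reflect fun i => θ ^ i]
    _ ≤ B / (1 - θ) := by
        rw [div_eq_mul_one_div]
        gcongr
        simpa using geom_sum_Ico_le_of_lt_one (m := 0) (n := n) hθ0 hθ1

theorem pref_eq_pref_iff_dist_le {n : ℕ} {x y : Seq} :
    pref n x = pref n y ↔ dist x y ≤ (1 / 2) ^ n :=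
  pref_eq_pref_iff.trans PiNat.mem_cylinder_iff_dist_le

theorem exists_isBowen_of_holderWith {φ : Seq → ℝ} {B r : ℝ≥0} (hr : 0 < r)
    (hφ : HolderWith B r φ) : ∃ C D : ℝ, IsBowen φ C D := by
  set θ : ℝ := (1 / 2 : ℝ) ^ (r : ℝ)
  have hvar : ∀ (n : ℕ) (x y : Seq), pref n x = pref n y → |φ x - φ y| ≤ B * θ ^ n := by
    intro n x y hxy
    calc |φ x - φ y| ≤ B * dist x y ^ (r : ℝ) := hφ.dist_le x y
      _ ≤ B * ((1 / 2 : ℝ) ^ n) ^ (r : ℝ) := by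
          gcongr
          exact pref_eq_pref_iff_dist_le.1 hxy
      _ = B * θ ^ n := by rw [Real.rpow_pow_comm (by norm_num)]
  refine ⟨B + |φ 0|, _, isBowen_of_abs_sub_le_pow (fun x => ?_) (by positivity)
    (Real.rpow_lt_one (by norm_num) (by norm_num) hr) hvar⟩
  have hx : |φ x - φ 0| ≤ B := by simpa using hvar 0 x 0 (Subsingleton.elim _ _)
  linarith [abs_sub_abs_le_abs_sub (φ x) (φ 0)]

/-! ### The transfer operator -/

/-- The points of `X` mapped to `x` by the `n`-th iterate of the shift. -/
noncomputable def preimages (X : Set Seq) (n : ℕ) (x : Seq) : Finset Seq :=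
  open Classical in {y ∈ (Finset.univ : Finset (Word n)).image (concat · x) | y ∈ X}

/-- The `n`-th iterate of the Ruelle transfer operator of the potential `g` on `X`. -/
noncomputable def transferOp (X : Set Seq) (g : Seq → ℝ) (n : ℕ) (f : Seq → ℝ) (x : Seq) : ℝ :=
  ∑ y ∈ preimages X n x, Real.exp (birkhoffSum shift g n y) * f y

section TransferOperator

variable {X : Set Seq} {g : Seq → ℝ} {C D : ℝ} {n : ℕ} {x y : Seq}

theorem mem_preimages : y ∈ preimages X n x ↔ y ∈ X ∧ shift^[n] y = x := by
  classical
  simp only [preimages, Finset.mem_filter, Finset.mem_image, Finset.mem_univ, true_and]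
  constructor
  · rintro ⟨⟨w, rfl⟩, h⟩
    exact ⟨h, iterate_shift_concat _ _⟩
  · rintro ⟨h, rfl⟩
    exact ⟨⟨pref n y, concat_pref_iterate_shift n y⟩, h⟩

theorem card_preimages_le (X : Set Seq) (n : ℕ) (x : Seq) : (preimages X n x).card ≤ 2 ^ n := by
  classical
  refine (Finset.card_filter_le _ _).trans (Finset.card_image_le.trans ?_)
  simp

theorem filter_preimages_add {m : ℕ} {z : Seq} (hz : z ∈ preimages X n x) [DecidableEq Seq] :
    {y ∈ preimages X (m + n) x | shift^[m] y = z} = preimages X m z := by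
  ext y
  rw [Finset.mem_filter, mem_preimages, mem_preimages, add_comm, Function.iterate_add_apply]
  exact ⟨fun h => ⟨h.1.1, h.2⟩, fun h => ⟨⟨h.1, h.2 ▸ (mem_preimages.1 hz).2⟩, h.2⟩⟩

theorem transferOp_add (hX : ∀ x ∈ X, shift x ∈ X) (g : Seq → ℝ) (m n : ℕ) (f : Seq → ℝ)
    (x : Seq) : transferOp X g (m + n) f x = transferOp X g n (transferOp X g m f) x := by
  classical
  have hmaps : ∀ y ∈ preimages X (m + n) x, shift^[m] y ∈ preimages X n x := by
    intro y hy
    rw [mem_preimages] at hy ⊢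
    exact ⟨iterate_shift_mem hX m hy.1, by rw [← Function.iterate_add_apply, add_comm n m, hy.2]⟩
  rw [transferOp, ← Finset.sum_fiberwise_of_maps_to hmaps]
  refine Finset.sum_congr rfl fun z hz => ?_
  rw [filter_preimages_add hz, transferOp, Finset.mul_sum]
  refine Finset.sum_congr rfl fun y hy => ?_
  rw [birkhoffSum_add, Real.exp_add, (mem_preimages.1 hy).2]
  ring

theorem transferOp_mono (g : Seq → ℝ) (n : ℕ) {f f' : Seq → ℝ} (h : ∀ y ∈ X, f y ≤ f' y)
    (x : Seq) : transferOp X g n f x ≤ transferOp X g n f' x :=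
  Finset.sum_le_sum fun y hy =>
    mul_le_mul_of_nonneg_left (h y (mem_preimages.1 hy).1) (Real.exp_nonneg _)

theorem transferOp_nonneg (g : Seq → ℝ) (n : ℕ) {f : Seq → ℝ} (h : ∀ y ∈ X, 0 ≤ f y) (x : Seq) :
    0 ≤ transferOp X g n f x :=
  Finset.sum_nonneg fun y hy => mul_nonneg (Real.exp_nonneg _) (h y (mem_preimages.1 hy).1)

theorem transferOp_const_mul (X : Set Seq) (g : Seq → ℝ) (n : ℕ) (f : Seq → ℝ) (c : ℝ)
    (x : Seq) : transferOp X g n (fun y => c * f y) x = c * transferOp X g n f x := by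
  simp only [transferOp, Finset.mul_sum, mul_left_comm c]

theorem transferOp_one (X : Set Seq) (g : Seq → ℝ) (n : ℕ) (x : Seq) :
    transferOp X g n 1 x = ∑ y ∈ preimages X n x, Real.exp (birkhoffSum shift g n y) := by
  simp [transferOp]

theorem transferOp_zero_apply (g : Seq → ℝ) (f : Seq → ℝ) (hx : x ∈ X) :
    transferOp X g 0 f x = f x := by
  have : preimages X 0 x = {x} := by
    ext y
    rw [mem_preimages, Finset.mem_singleton, Function.iterate_zero, id]
    exact ⟨And.right, fun h => ⟨h ▸ hx, h⟩⟩
  simp [transferOp, this]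

theorem transferOp_one_le_pow (X : Set Seq) (hg : IsBowen g C D) (n : ℕ) (x : Seq) :
    transferOp X g n 1 x ≤ (2 * Real.exp C) ^ n := by
  rw [transferOp_one]
  calc ∑ y ∈ preimages X n x, Real.exp (birkhoffSum shift g n y)
      ≤ (preimages X n x).card • Real.exp C ^ n := by
        refine Finset.sum_le_card_nsmul _ _ _ fun y _ => ?_
        rw [← Real.exp_nat_mul]
        exact Real.exp_le_exp.2 ((le_abs_self _).trans (hg.abs_birkhoffSum_le n y))
    _ ≤ 2 ^ n * Real.exp C ^ n := by
        rw [nsmul_eq_mul]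
        gcongr
        exact_mod_cast card_preimages_le X n x
    _ = (2 * Real.exp C) ^ n := (mul_pow _ _ _).symm

theorem bddAbove_birkhoffSum_cyl (hg : IsBowen g C D) (w : Word n) :
    BddAbove (birkhoffSum shift g n '' cyl w) := by
  refine ⟨n * C, ?_⟩
  rintro _ ⟨x, -, rfl⟩
  exact (le_abs_self _).trans (hg.abs_birkhoffSum_le n x)

theorem transferOp_one_le_partitionSum (X : Set Seq) (hg : IsBowen g C D) (n : ℕ) (x : Seq) :
    transferOp X g n 1 x ≤ partitionSum X g n := by
  classical
  have hinj : Set.InjOn (pref n) (preimages X n x : Set Seq) := by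
    intro y hy y' hy' h
    rw [← concat_pref_iterate_shift n y, ← concat_pref_iterate_shift n y', h,
      (mem_preimages.1 hy).2, (mem_preimages.1 hy').2]
  rw [transferOp_one, partitionSum]
  calc ∑ y ∈ preimages X n x, Real.exp (birkhoffSum shift g n y)
      ≤ ∑ y ∈ preimages X n x, Real.exp (sSup (birkhoffSum shift g n '' cyl (pref n y))) := by
        gcongr with y
        exact le_csSup (bddAbove_birkhoffSum_cyl hg _) ⟨y, rfl, rfl⟩
    _ = ∑ w ∈ (preimages X n x).image (pref n),
          Real.exp (sSup (birkhoffSum shift g n '' cyl w)) :=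
        (Finset.sum_image (f := fun w => Real.exp (sSup (birkhoffSum shift g n '' cyl w)))
          hinj).symm
    _ ≤ _ := by
        refine Finset.sum_le_sum_of_subset_of_nonneg ?_ fun _ _ _ => Real.exp_nonneg _
        intro w hw
        obtain ⟨y, hy, rfl⟩ := Finset.mem_image.1 hw
        exact Finset.mem_filter.2 ⟨Finset.mem_univ _, y, rfl, (mem_preimages.1 hy).1⟩

end TransferOperator

/-! ### Growth of the transfer operator and existence of the pressure -/

/-- The one-sided subshifts for which the thermodynamic formalism is developed: forward invariant
sets in which a word read off a point may be replaced in front of any point with the same `m`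
letters (Markov property with memory `m`), and in which any cylinder of length `m` is joined to any
point by a path of length at most `R`. -/
structure IsTransitiveMarkov (m R : ℕ) (X : Set Seq) : Prop where
  nonempty : X.Nonempty
  shift_mem : ∀ x ∈ X, shift x ∈ X
  concat_mem : ∀ n : ℕ, ∀ y ∈ X, ∀ x ∈ X, pref m (shift^[n] y) = pref m x →
    concat (pref n y) x ∈ X
  link : ∀ x ∈ X, ∀ y ∈ X, ∃ r ≤ R, ∃ z ∈ X, pref m z = pref m y ∧ shift^[r] z = x

/-- The constant by which the partition sums of a transitive Markov set with links of length at most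
`R` may differ from the iterates of the transfer operator of a potential with bounds `C` and `D`:
there are `R + 1` lengths of links, each of which costs at most `R * C` in the exponent and carries
at most `2 ^ R` words. -/
noncomputable def linkConst (R : ℕ) (C D : ℝ) : ℝ :=
  Real.exp (D + R * C) * ((R + 1) * (2 * Real.exp C) ^ R)

theorem partitionSum_pos {X : Set Seq} (hX : X.Nonempty) (g : Seq → ℝ) (n : ℕ) :
    0 < partitionSum X g n := by
  classical
  obtain ⟨x, hx⟩ := hX
  refine Finset.sum_pos (fun _ _ => Real.exp_pos _) ⟨pref n x, ?_⟩
  exact Finset.mem_filter.2 ⟨Finset.mem_univ _, x, rfl, hx⟩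

section Growth

variable {m R : ℕ} {X : Set Seq} {g : Seq → ℝ} {C D : ℝ} {x : Seq}

theorem IsBowen.one_le_linkConst (hg : IsBowen g C D) (R : ℕ) : 1 ≤ linkConst R C D := by
  have hC := hg.bound_nonneg
  have hD := hg.distortion_nonneg
  have h1 : 1 ≤ Real.exp (D + R * C) := Real.one_le_exp (by positivity)
  have h2 : 1 ≤ (2 * Real.exp C) ^ R := one_le_pow₀ (by linarith [Real.one_le_exp hC])
  have h3 : (1 : ℝ) ≤ R + 1 := by simp
  exact one_le_mul_of_one_le_of_one_le h1 (one_le_mul_of_one_le_of_one_le h3 h2)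

theorem IsBowen.exp_sSup_cyl_le (hg : IsBowen g C D) {n r : ℕ} (hr : r ≤ R) (v : Seq) :
    Real.exp (sSup (birkhoffSum shift g n '' cyl (pref n v))) ≤
      Real.exp (D + R * C) * Real.exp (birkhoffSum shift g (n + r) v) := by
  rw [← Real.exp_add, Real.exp_le_exp]
  refine csSup_le ⟨_, v, rfl, rfl⟩ ?_
  rintro _ ⟨y, hy, rfl⟩
  have hlink : (r : ℝ) * C ≤ R * C := by
    have := hg.bound_nonneg
    gcongr
  rw [birkhoffSum_add]
  linarith [hg.birkhoffSum_le_add (x := y) (y := v) hy,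
    (abs_le.1 (hg.abs_birkhoffSum_le r (shift^[n] v))).1]

namespace IsTransitiveMarkov

theorem exists_mem_preimages_pref_eq (hX : IsTransitiveMarkov m R X) (hx : x ∈ X) {n : ℕ}
    {w : Word n} (hw : (cyl w ∩ X).Nonempty) :
    ∃ r ≤ R, ∃ v ∈ preimages X (n + r) x, pref n v = w := by
  obtain ⟨y, rfl, hy⟩ := hw
  obtain ⟨r, hr, z, hz, hzy, hzx⟩ := hX.link x hx _ (iterate_shift_mem hX.shift_mem n hy)
  refine ⟨r, hr, concat (pref n y) z, mem_preimages.2 ⟨hX.concat_mem n y hy z hz hzy.symm, ?_⟩,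
    pref_concat _ _⟩
  rw [add_comm, Function.iterate_add_apply, iterate_shift_concat, hzx]

theorem partitionSum_le_sum_transferOp (hX : IsTransitiveMarkov m R X) (hg : IsBowen g C D)
    (n : ℕ) (hx : x ∈ X) :
    partitionSum X g n ≤
      Real.exp (D + R * C) * ∑ r ∈ Finset.range (R + 1), transferOp X g (n + r) 1 x := by
  classical
  have hlink : ∀ w : Word n, (cyl w ∩ X).Nonempty →
      ∃ p : Σ _ : ℕ, Seq, p.1 ≤ R ∧ p.2 ∈ preimages X (n + p.1) x ∧ pref n p.2 = w := by
    intro w hw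
    obtain ⟨r, hr, v, hv⟩ := hX.exists_mem_preimages_pref_eq hx hw
    exact ⟨⟨r, v⟩, hr, hv⟩
  choose! p hpR hpx hpw using hlink
  set W : Finset (Word n) := {w | (cyl w ∩ X).Nonempty}
  have hW : ∀ w ∈ W, (cyl w ∩ X).Nonempty := fun w hw => (Finset.mem_filter.1 hw).2
  have hinj : Set.InjOn p W := by
    intro w hw w' hw' h
    rw [← hpw w (hW w hw), ← hpw w' (hW w' hw'), h]
  calc partitionSum X g n
      ≤ ∑ w ∈ W, Real.exp (D + R * C) *
          Real.exp (birkhoffSum shift g (n + (p w).1) (p w).2) := by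
        refine Finset.sum_le_sum fun w hw => ?_
        have := hg.exp_sSup_cyl_le (n := n) (hpR w (hW w hw)) (p w).2
        rwa [hpw w (hW w hw)] at this
    _ = Real.exp (D + R * C) *
          ∑ s ∈ W.image p, Real.exp (birkhoffSum shift g (n + s.1) s.2) := by
        rw [Finset.sum_image hinj, Finset.mul_sum]
    _ ≤ Real.exp (D + R * C) * ∑ s ∈ (Finset.range (R + 1)).sigma fun r => preimages X (n + r) x,
          Real.exp (birkhoffSum shift g (n + s.1) s.2) := by
        gcongr
        intro s hs
        obtain ⟨w, hw, rfl⟩ := Finset.mem_image.1 hs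
        exact Finset.mem_sigma.2
          ⟨Finset.mem_range.2 (Nat.lt_succ_of_le (hpR w (hW w hw))), hpx w (hW w hw)⟩
    _ = _ := by simp only [Finset.sum_sigma, transferOp_one]

theorem partitionSum_le (hX : IsTransitiveMarkov m R X) (hg : IsBowen g C D) (n : ℕ)
    (hx : x ∈ X) : partitionSum X g n ≤ linkConst R C D * transferOp X g n 1 x := by
  have hC : 1 ≤ 2 * Real.exp C := by linarith [Real.one_le_exp hg.bound_nonneg]
  have hterm : ∀ r ∈ Finset.range (R + 1),
      transferOp X g (n + r) 1 x ≤ (2 * Real.exp C) ^ R * transferOp X g n 1 x := by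
    intro r hr
    rw [add_comm, transferOp_add hX.shift_mem, ← transferOp_const_mul]
    refine transferOp_mono g n (fun y _ => ?_) x
    rw [Pi.one_apply, mul_one]
    exact (transferOp_one_le_pow X hg r y).trans
      (pow_le_pow_right₀ hC (Nat.le_of_lt_succ (Finset.mem_range.1 hr)))
  calc partitionSum X g n
      ≤ Real.exp (D + R * C) * ∑ r ∈ Finset.range (R + 1), transferOp X g (n + r) 1 x :=
        hX.partitionSum_le_sum_transferOp hg n hx
    _ ≤ Real.exp (D + R * C) * ((R + 1) * ((2 * Real.exp C) ^ R * transferOp X g n 1 x)) := by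
        gcongr
        simpa using Finset.sum_le_card_nsmul _ _ _ hterm
    _ = linkConst R C D * transferOp X g n 1 x := by
        rw [linkConst]
        ring

theorem inv_mul_partitionSum_le (hX : IsTransitiveMarkov m R X) (hg : IsBowen g C D) (n : ℕ)
    (hx : x ∈ X) : (linkConst R C D)⁻¹ * partitionSum X g n ≤ transferOp X g n 1 x :=
  inv_mul_le_of_le_mul₀ (zero_le_one.trans (hg.one_le_linkConst R))
    (transferOp_nonneg g n (fun _ _ => zero_le_one) x) (hX.partitionSum_le hg n hx)

theorem partitionSum_add_le (hX : IsTransitiveMarkov m R X) (hg : IsBowen g C D) (k n : ℕ) :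
    partitionSum X g (k + n) ≤
      linkConst R C D * (partitionSum X g k * partitionSum X g n) := by
  obtain ⟨x, hx⟩ := hX.nonempty
  have hK := zero_le_one.trans (hg.one_le_linkConst R)
  have hZ := (partitionSum_pos hX.nonempty g k).le
  calc partitionSum X g (k + n)
      ≤ linkConst R C D * transferOp X g n (transferOp X g k 1) x := by
        rw [← transferOp_add hX.shift_mem]
        exact hX.partitionSum_le hg _ hx
    _ ≤ linkConst R C D * transferOp X g n (fun y => partitionSum X g k * (1 : Seq → ℝ) y) x := by
        gcongr
        refine transferOp_mono g n (fun y _ => ?_) x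
        simpa using transferOp_one_le_partitionSum X hg k y
    _ ≤ _ := by
        rw [transferOp_const_mul]
        gcongr
        exact transferOp_one_le_partitionSum X hg n x

theorem mul_partitionSum_le (hX : IsTransitiveMarkov m R X) (hg : IsBowen g C D) (k n : ℕ) :
    partitionSum X g k * partitionSum X g n ≤
      linkConst R C D ^ 2 * partitionSum X g (k + n) := by
  obtain ⟨x, hx⟩ := hX.nonempty
  have hK := zero_lt_one.trans_le (hg.one_le_linkConst R)
  have hZ := (partitionSum_pos hX.nonempty g k).le
  set K := linkConst R C D
  rw [← inv_mul_le_iff₀ (by positivity)]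
  calc (K ^ 2)⁻¹ * (partitionSum X g k * partitionSum X g n)
      = K⁻¹ * partitionSum X g k * (K⁻¹ * partitionSum X g n) := by ring
    _ ≤ K⁻¹ * partitionSum X g k * transferOp X g n 1 x := by
        gcongr
        exact hX.inv_mul_partitionSum_le hg n hx
    _ ≤ transferOp X g n (transferOp X g k 1) x := by
        rw [← transferOp_const_mul]
        refine transferOp_mono g n (fun y hy => ?_) x
        simpa using hX.inv_mul_partitionSum_le hg k hy
    _ ≤ partitionSum X g (k + n) := by
        rw [← transferOp_add hX.shift_mem]
        exact transferOp_one_le_partitionSum X hg _ x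

theorem abs_log_partitionSum_add_sub_le (hX : IsTransitiveMarkov m R X) (hg : IsBowen g C D)
    (k n : ℕ) : |Real.log (partitionSum X g (k + n)) - Real.log (partitionSum X g k) -
      Real.log (partitionSum X g n)| ≤ 2 * Real.log (linkConst R C D) := by
  have hK := zero_lt_one.trans_le (hg.one_le_linkConst R)
  have hZ := fun j => partitionSum_pos hX.nonempty g j
  have hlogK := Real.log_nonneg (hg.one_le_linkConst R)
  have hupper := Real.log_le_log (hZ _) (hX.partitionSum_add_le hg k n)
  have hlower := Real.log_le_log (mul_pos (hZ _) (hZ _)) (hX.mul_partitionSum_le hg k n)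
  rw [Real.log_mul (by positivity) (mul_pos (hZ _) (hZ _)).ne',
    Real.log_mul (hZ _).ne' (hZ _).ne'] at hupper
  rw [Real.log_mul (hZ _).ne' (hZ _).ne', Real.log_mul (by positivity) (hZ _).ne',
    Real.log_pow] at hlower
  push_cast at hlower
  rw [abs_le]
  constructor <;> linarith

end IsTransitiveMarkov

end Growth

theorem bddBelow_range_div_natCast {u : ℕ → ℝ} {M : ℝ} (hM : 0 ≤ M)
    (hu : ∀ n : ℕ, -(n * M) ≤ u n) : BddBelow (range fun n => u n / n) := by
  refine ⟨-M, ?_⟩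
  rintro _ ⟨n, rfl⟩
  rcases n.eq_zero_or_pos with rfl | hn
  · simpa using hM
  · rw [le_div_iff₀ (by exact_mod_cast hn)]
    linarith [hu n]

section Fekete

variable {b : ℕ → ℝ} {K : ℝ}

theorem abs_le_of_abs_add_sub_le (hb : ∀ m n, |b (m + n) - b m - b n| ≤ K) (n : ℕ) :
    |b n| ≤ n * (|b 1| + K) + K := by
  induction n with
  | zero => simpa using hb 0 0
  | succ n ih =>
    have h1 := abs_le.1 (hb n 1)
    have h2 := abs_le.1 ih
    have h3 := abs_le.1 (le_refl |b 1|)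
    push_cast
    rw [abs_le]
    constructor <;> linarith

theorem exists_tendsto_div_of_abs_add_sub_le (hb : ∀ m n, |b (m + n) - b m - b n| ≤ K) :
    ∃ L, Tendsto (fun n : ℕ => b n / n) atTop (𝓝 L) ∧ ∀ n : ℕ, |b n - n * L| ≤ K := by
  set u : ℕ → ℝ := fun n => b n + K
  set v : ℕ → ℝ := fun n => K - b n
  have hu : Subadditive u := fun m n => by linarith [(abs_le.1 (hb m n)).2]
  have hv : Subadditive v := fun m n => by linarith [(abs_le.1 (hb m n)).1]
  have hM : 0 ≤ |b 1| + K := add_nonneg (abs_nonneg _) ((abs_nonneg _).trans (hb 0 0))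
  have hubdd : BddBelow (range fun n => u n / n) := bddBelow_range_div_natCast hM fun n => by
    linarith [(abs_le.1 (abs_le_of_abs_add_sub_le hb n)).1]
  have hvbdd : BddBelow (range fun n => v n / n) := bddBelow_range_div_natCast hM fun n => by
    linarith [(abs_le.1 (abs_le_of_abs_add_sub_le hb n)).2]
  have hK0 : Tendsto (fun n : ℕ => K / n) atTop (𝓝 0) := tendsto_const_div_atTop_nhds_zero_nat K
  have hlim : Tendsto (fun n : ℕ => b n / n) atTop (𝓝 hu.lim) := by
    simpa [u, add_div] using (hu.tendsto_lim hubdd).sub hK0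
  have hlim' : Tendsto (fun n : ℕ => b n / n) atTop (𝓝 (-hv.lim)) := by
    simpa [v, sub_div] using hK0.sub (hv.tendsto_lim hvbdd)
  have hneg : hv.lim = -hu.lim := by linarith [tendsto_nhds_unique hlim hlim']
  refine ⟨hu.lim, hlim, fun n => ?_⟩
  rcases n.eq_zero_or_pos with rfl | hn
  · simpa using hb 0 0
  · have hn' : (0 : ℝ) < n := by exact_mod_cast hn
    have h1 := hu.lim_le_div hubdd hn.ne'
    have h2 := hv.lim_le_div hvbdd hn.ne'
    rw [hneg] at h2
    rw [le_div_iff₀ hn'] at h1 h2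
    rw [abs_le]
    constructor <;> simp only [u, v] at h1 h2 <;> linarith

end Fekete

theorem pressureSeq_eq_log_div (X : Set Seq) (g : Seq → ℝ) :
    pressureSeq X g = fun n : ℕ => Real.log (partitionSum X g n) / n := by
  funext n
  rw [pressureSeq, one_div, inv_mul_eq_div]

namespace IsTransitiveMarkov

variable {m R : ℕ} {X : Set Seq} {g : Seq → ℝ} {C D : ℝ} {x : Seq}

theorem tendsto_pressureSeq_and_abs_sub_le (hX : IsTransitiveMarkov m R X)
    (hg : IsBowen g C D) : Tendsto (pressureSeq X g) atTop (𝓝 (pressure X g)) ∧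
      ∀ n : ℕ, |Real.log (partitionSum X g n) - n * pressure X g| ≤
        2 * Real.log (linkConst R C D) := by
  obtain ⟨L, hL, hbound⟩ :=
    exists_tendsto_div_of_abs_add_sub_le (b := fun n => Real.log (partitionSum X g n))
      (hX.abs_log_partitionSum_add_sub_le hg)
  rw [← pressureSeq_eq_log_div] at hL
  have hP : pressure X g = L := hL.limUnder_eq
  exact hP ▸ ⟨hL, hbound⟩

theorem tendsto_pressureSeq (hX : IsTransitiveMarkov m R X) (hg : IsBowen g C D) :
    Tendsto (pressureSeq X g) atTop (𝓝 (pressure X g)) :=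
  (hX.tendsto_pressureSeq_and_abs_sub_le hg).1

theorem transferOp_one_le_exp (hX : IsTransitiveMarkov m R X) (hg : IsBowen g C D) (n : ℕ)
    (x : Seq) :
    transferOp X g n 1 x ≤ linkConst R C D ^ 2 * Real.exp (n * pressure X g) := by
  have hK := zero_lt_one.trans_le (hg.one_le_linkConst R)
  refine (transferOp_one_le_partitionSum X hg n x).trans ?_
  rw [← Real.log_le_log_iff (partitionSum_pos hX.nonempty g n) (by positivity),
    Real.log_mul (by positivity) (Real.exp_ne_zero _), Real.log_pow, Real.log_exp]
  push_cast
  linarith [le_of_abs_le ((hX.tendsto_pressureSeq_and_abs_sub_le hg).2 n)]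

theorem exp_le_transferOp_one (hX : IsTransitiveMarkov m R X) (hg : IsBowen g C D) (n : ℕ)
    (hx : x ∈ X) :
    Real.exp (n * pressure X g) ≤ linkConst R C D ^ 3 * transferOp X g n 1 x := by
  have hK := zero_lt_one.trans_le (hg.one_le_linkConst R)
  have hZ := partitionSum_pos hX.nonempty g n
  calc Real.exp (n * pressure X g) ≤ linkConst R C D ^ 2 * partitionSum X g n := by
        rw [← Real.le_log_iff_exp_le (by positivity), Real.log_mul (by positivity) hZ.ne',
          Real.log_pow]
        push_cast
        linarith [neg_le_of_abs_le ((hX.tendsto_pressureSeq_and_abs_sub_le hg).2 n)]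
    _ ≤ linkConst R C D ^ 2 * (linkConst R C D * transferOp X g n 1 x) := by
        gcongr
        exact hX.partitionSum_le hg n hx
    _ = linkConst R C D ^ 3 * transferOp X g n 1 x := by ring

theorem transferOp_one_pos (hX : IsTransitiveMarkov m R X) (hg : IsBowen g C D) (n : ℕ)
    (hx : x ∈ X) : 0 < transferOp X g n 1 x := by
  have hK := zero_lt_one.trans_le (hg.one_le_linkConst R)
  exact pos_of_mul_pos_right ((Real.exp_pos _).trans_le (hX.exp_le_transferOp_one hg n hx))
    (by positivity)

theorem tendsto_log_transferOp_one_div (hX : IsTransitiveMarkov m R X) (hg : IsBowen g C D)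
    (hx : x ∈ X) :
    Tendsto (fun n : ℕ => Real.log (transferOp X g n 1 x) / n) atTop (𝓝 (pressure X g)) := by
  have hZ := hX.tendsto_pressureSeq hg
  rw [pressureSeq_eq_log_div] at hZ
  have hZ' : Tendsto (fun n : ℕ =>
      (Real.log (partitionSum X g n) - Real.log (linkConst R C D)) / n) atTop
      (𝓝 (pressure X g)) := by
    simpa [sub_div] using hZ.sub (tendsto_const_div_atTop_nhds_zero_nat _)
  refine tendsto_of_tendsto_of_tendsto_of_le_of_le hZ' hZ (fun n => ?_) fun n => ?_
  all_goals have hop := hX.transferOp_one_pos hg n hx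
  · have h := Real.log_le_log (partitionSum_pos hX.nonempty g n) (hX.partitionSum_le hg n hx)
    rw [Real.log_mul (zero_lt_one.trans_le (hg.one_le_linkConst R)).ne' hop.ne'] at h
    dsimp only
    gcongr
    linarith
  · dsimp only
    gcongr
    exact transferOp_one_le_partitionSum X hg n x

end IsTransitiveMarkov

/-! ### Convexity and differentiability of the pressure -/

theorem birkhoffSum_const_mul (q : ℝ) (g : Seq → ℝ) (n : ℕ) (x : Seq) :
    birkhoffSum shift (fun y => q * g y) n x = q * birkhoffSum shift g n x := by
  simp only [birkhoffSum, Finset.mul_sum]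

theorem convexOn_log_sum_exp {ι : Type*} (s : Finset ι) (a : ι → ℝ) :
    ConvexOn ℝ univ fun q : ℝ => Real.log (∑ i ∈ s, Real.exp (q * a i)) := by
  rcases s.eq_empty_or_nonempty with rfl | hs
  · simpa using convexOn_const (0 : ℝ) convex_univ
  set L : ℝ → ℝ := fun q => Real.log (∑ i ∈ s, Real.exp (q * a i))
  have hpos : ∀ q : ℝ, 0 < ∑ i ∈ s, Real.exp (q * a i) := fun q =>
    Finset.sum_pos (fun i _ => Real.exp_pos _) hs
  have hsum : ∀ q, ∑ i ∈ s, Real.exp (q * a i - L q) = 1 := by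
    intro q
    simp only [Real.exp_sub, ← Finset.sum_div, L, Real.exp_log (hpos q)]
    exact div_self (hpos q).ne'
  refine ⟨convex_univ, fun p _ q _ α β hα hβ hαβ => ?_⟩
  simp only [smul_eq_mul]
  rw [Real.log_le_iff_le_exp (hpos _), ← mul_one (Real.exp _), ← inv_mul_le_iff₀ (Real.exp_pos _),
    ← Real.exp_neg, Finset.mul_sum]
  calc ∑ i ∈ s, Real.exp (-(α * L p + β * L q)) * Real.exp ((α * p + β * q) * a i)
      = ∑ i ∈ s, Real.exp (α * (p * a i - L p) + β * (q * a i - L q)) := by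
        refine Finset.sum_congr rfl fun i _ => ?_
        rw [← Real.exp_add]
        ring_nf
    _ ≤ ∑ i ∈ s, (α * Real.exp (p * a i - L p) + β * Real.exp (q * a i - L q)) :=
        Finset.sum_le_sum fun i _ => convexOn_exp.2 (mem_univ _) (mem_univ _) hα hβ hαβ
    _ = 1 := by rw [Finset.sum_add_distrib, ← Finset.mul_sum, ← Finset.mul_sum, hsum, hsum,
        mul_one, mul_one, hαβ]

theorem IsTransitiveMarkov.convexOn_pressure {m R : ℕ} {X : Set Seq} {φ : Seq → ℝ} {C D : ℝ}
    (hX : IsTransitiveMarkov m R X) (hφ : IsBowen φ C D) :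
    ConvexOn ℝ univ fun q : ℝ => pressure X fun x => q * φ x := by
  obtain ⟨x, hx⟩ := hX.nonempty
  have hlim : Tendsto (fun (n : ℕ) (q : ℝ) =>
      Real.log (transferOp X (fun x => q * φ x) n 1 x) / n) atTop
      (𝓝 fun q => pressure X fun x => q * φ x) :=
    tendsto_pi_nhds.2 fun q => hX.tendsto_log_transferOp_one_div (hφ.const_mul q) hx
  refine isClosed_setOfPred_convexOn.mem_of_tendsto hlim (Eventually.of_forall fun n => ?_)
  rw [mem_ofPred_eq]
  have := (convexOn_log_sum_exp (preimages X n x) (birkhoffSum shift φ n)).smul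
    (inv_nonneg.2 (Nat.cast_nonneg n))
  simpa only [transferOp_one, birkhoffSum_const_mul, smul_eq_mul, inv_mul_eq_div] using this

theorem exists_kink_of_not_differentiableAt {P : ℝ → ℝ} {q₀ : ℝ} (hP : ConvexOn ℝ univ P)
    (hdiff : ¬DifferentiableAt ℝ P q₀) :
    ∃ α β : ℝ, β < α ∧ (∀ h > 0, α * h ≤ P (q₀ + h) - P q₀) ∧
      (∀ h > 0, P q₀ - P (q₀ - h) ≤ β * h) ∧
      ∀ ε > 0, ∃ h ∈ Ioc (0 : ℝ) 1, P (q₀ + h) - P q₀ ≤ (α + ε) * h := by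
  have hint : q₀ ∈ interior (univ : Set ℝ) := by simp
  have hr := hP.hasDerivWithinAt_rightDeriv_of_mem_interior hint
  have hl := hP.hasDerivWithinAt_leftDeriv_of_mem_interior hint
  set α := derivWithin P (Ioi q₀) q₀
  set β := derivWithin P (Iio q₀) q₀
  have hβα : β < α := by
    refine (hP.leftDeriv_le_rightDeriv_of_mem_interior hint).lt_of_ne fun heq : β = α => hdiff ?_
    have h := (heq ▸ hl).Iic_of_Iio.union hr.Ici_of_Ioi
    rw [Iic_union_Ici, hasDerivWithinAt_univ] at h
    exact h.differentiableAt
  refine ⟨α, β, hβα, fun h hh => ?_, fun h hh => ?_, fun ε hε => ?_⟩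
  · have := hP.rightDeriv_le_slope (mem_univ q₀) (mem_univ (q₀ + h)) (by linarith)
      hr.differentiableWithinAt
    rwa [slope_def_field, add_sub_cancel_left, le_div_iff₀ hh] at this
  · have := hP.slope_le_leftDeriv (mem_univ (q₀ - h)) (mem_univ q₀) (by linarith)
      hl.differentiableWithinAt
    rwa [slope_def_field, sub_sub_cancel, div_le_iff₀ hh] at this
  · have hslope := hasDerivWithinAt_iff_tendsto_slope.1 hr
    rw [sdiff_singleton_eq_self self_notMem_Ioi] at hslope
    have hlt := hslope.eventually (ge_mem_nhds (by linarith : α < α + ε))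
    have hmem : ∀ᶠ q in 𝓝[>] q₀, q ∈ Ioc q₀ (q₀ + 1) := Ioc_mem_nhdsGT (by linarith)
    obtain ⟨q, hq, hq0, hq1⟩ := (hlt.and hmem).exists
    rw [slope_def_field, div_le_iff₀ (by linarith)] at hq
    exact ⟨q - q₀, ⟨by linarith, by linarith⟩, by rwa [add_sub_cancel]⟩

theorem le_of_forall_pow_le_mul_pow {a b c : ℝ} (ha : 0 < a) (hc : 0 < c)
    (h : ∀ k : ℕ, a ^ k ≤ c * b ^ k) : a ≤ b := by
  by_contra! hba
  have hb : 0 < b := pos_of_mul_pos_right (ha.trans_le (by simpa using h 1)) hc.le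
  have hlim : Tendsto (fun k : ℕ => c * (b / a) ^ k) atTop (𝓝 0) := by
    simpa using (tendsto_pow_atTop_nhds_zero_of_lt_one (by positivity)
      ((div_lt_one ha).2 hba)).const_mul c
  refine absurd (ge_of_tendsto' hlim fun k => ?_) (not_le.2 (zero_lt_one' ℝ))
  rw [div_pow, ← mul_div_assoc, le_div_iff₀ (by positivity), one_mul]
  exact h k

theorem exp_le_combination {b t γ ε u s : ℝ} (ht : 0 ≤ t) (hγ : 0 ≤ γ) (hε : 0 ≤ ε) (hu : 1 ≤ u)
    (hs : -b ≤ s) :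
    Real.exp s ≤ Real.exp ε - (1 - Real.exp (-(γ / 2))) * Real.exp (-(b * t)) *
      (Real.exp (-(t * s)) - Real.exp (t * γ / 2)) + Real.exp (ε - u * ε) * Real.exp (u * s) := by
  set κ := 1 - Real.exp (-(γ / 2))
  have hκ : 0 ≤ κ := sub_nonneg.2 (Real.exp_le_one_iff.2 (by linarith))
  have hlast : 0 ≤ Real.exp (ε - u * ε) * Real.exp (u * s) := by positivity
  rcases lt_or_ge (-(γ / 2)) s with hlow | hlow
  · have hsub : κ * Real.exp (-(b * t)) * (Real.exp (-(t * s)) - Real.exp (t * γ / 2)) ≤ 0 := by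
      refine mul_nonpos_of_nonneg_of_nonpos (by positivity) (sub_nonpos.2 (Real.exp_le_exp.2 ?_))
      nlinarith
    rcases le_or_gt s ε with hsε | hsε
    · linarith [Real.exp_le_exp.2 hsε]
    · have : Real.exp s ≤ Real.exp (ε - u * ε) * Real.exp (u * s) := by
        rw [← Real.exp_add]
        exact Real.exp_le_exp.2 (by nlinarith)
      linarith [Real.exp_pos ε]
  · have hsub : Real.exp (-(b * t)) * (Real.exp (-(t * s)) - Real.exp (t * γ / 2)) ≤ 1 := by
      have h1 : Real.exp (-(b * t)) * Real.exp (-(t * s)) ≤ 1 := by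
        rw [← Real.exp_add]
        exact Real.exp_le_one_iff.2 (by nlinarith)
      have h2 : 0 ≤ Real.exp (-(b * t)) * Real.exp (t * γ / 2) := by positivity
      linarith
    have hκsub := mul_le_mul_of_nonneg_left hsub hκ
    have hexp : Real.exp s ≤ 1 - κ := (Real.exp_le_exp.2 hlow).trans_eq (sub_sub_cancel _ _).symm
    linarith [Real.one_le_exp hε]

/- If `exp (-t * s)` has average at least `exp (t * γ) / K`, and that of `exp (u * s)` grows more
slowly than `exp (u * ε)`, then for large `u` the average of `exp s` is less than `1`. -/
theorem exists_exp_le_combination (b : ℝ) {γ K : ℝ} (hγ : 0 < γ) (hK : 1 ≤ K) :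
    ∃ t > 0, ∃ κ ≥ 0, ∃ ε > 0, ∃ A < 1 + κ * (Real.exp (t * γ) / K), ∀ u ≥ 1, ∀ s ≥ -b,
      Real.exp s ≤ A - κ * Real.exp (-(t * s)) + Real.exp (ε - u * ε) * Real.exp (u * s) := by
  have hK0 := zero_lt_one.trans_le hK
  set t := 2 * Real.log (2 * K) / γ
  have ht : 0 < t := by
    have := Real.log_pos (by linarith : 1 < 2 * K)
    positivity
  have htγ : Real.exp (t * γ / 2) = 2 * K := by
    have hlog : t * γ / 2 = Real.log (2 * K) := by
      simp only [t]
      field_simp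
    rw [hlog, Real.exp_log (by positivity)]
  set κ := (1 - Real.exp (-(γ / 2))) * Real.exp (-(b * t))
  have hκ : 0 < κ :=
    mul_pos (sub_pos.2 (Real.exp_lt_one_iff.2 (by linarith))) (Real.exp_pos _)
  have hgain : Real.exp (t * γ) / K = 4 * K := by
    rw [← add_halves (t * γ), Real.exp_add, htγ]
    field_simp
    norm_num
  refine ⟨t, ht, κ, hκ.le, Real.log (1 + κ * K), Real.log_pos (by linarith [mul_pos hκ hK0]),
    (1 + κ * K) + κ * (2 * K), ?_, fun u hu s hs => ?_⟩
  · rw [hgain]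
    linarith [mul_pos hκ hK0]
  · have h := exp_le_combination ht.le hγ.le (Real.log_nonneg (by linarith [mul_pos hκ hK0]) :
      0 ≤ Real.log (1 + κ * K)) hu hs
    rw [htγ, Real.exp_log (by positivity)] at h
    linarith

theorem IsBowen.const_mul_of_abs_le {g : Seq → ℝ} {C D q Q : ℝ} (hg : IsBowen g C D)
    (hq : |q| ≤ Q) : IsBowen (fun x => q * g x) (Q * C) (Q * D) :=
  (hg.const_mul q).mono (mul_le_mul_of_nonneg_right hq hg.bound_nonneg)
    (mul_le_mul_of_nonneg_right hq hg.distortion_nonneg)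

namespace IsTransitiveMarkov

variable {m R : ℕ} {X : Set Seq} {g g' g₁ : Seq → ℝ} {C D : ℝ} {x : Seq}

theorem transferOp_transferOp_one_le (hX : IsTransitiveMarkov m R X) (hg : IsBowen g C D)
    (hg' : IsBowen g' C D) (hg₁ : IsBowen g₁ C D) (n l : ℕ) (hx : x ∈ X) :
    transferOp X g n (transferOp X g₁ l 1) x ≤ linkConst R C D ^ 10 *
      Real.exp (n * (pressure X g - pressure X g')) *
        transferOp X g' n (transferOp X g₁ l 1) x := by
  have hK := zero_lt_one.trans_le (hg.one_le_linkConst R)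
  set K := linkConst R C D
  set f := transferOp X g₁ l 1
  set E := Real.exp (l * pressure X g₁)
  have hupper : transferOp X g n f x ≤ K ^ 4 * E * Real.exp (n * pressure X g) := by
    calc transferOp X g n f x ≤ transferOp X g n (fun y => K ^ 2 * E * (1 : Seq → ℝ) y) x :=
          transferOp_mono g n (fun y _ => by simpa using hX.transferOp_one_le_exp hg₁ l y) x
      _ ≤ K ^ 2 * E * (K ^ 2 * Real.exp (n * pressure X g)) := by
          rw [transferOp_const_mul]
          gcongr
          exact hX.transferOp_one_le_exp hg n x
      _ = K ^ 4 * E * Real.exp (n * pressure X g) := by ring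
  have hlower : E * Real.exp (n * pressure X g') ≤ K ^ 6 * transferOp X g' n f x := by
    calc E * Real.exp (n * pressure X g') ≤ E * (K ^ 3 * transferOp X g' n 1 x) := by
          gcongr
          exact hX.exp_le_transferOp_one hg' n hx
      _ = K ^ 3 * transferOp X g' n (fun y => E * (1 : Seq → ℝ) y) x := by
          rw [transferOp_const_mul]
          ring
      _ ≤ K ^ 3 * transferOp X g' n (fun y => K ^ 3 * f y) x := by
          gcongr
          refine transferOp_mono g' n (fun y hy => ?_) x
          simpa using hX.exp_le_transferOp_one hg₁ l hy
      _ = K ^ 6 * transferOp X g' n f x := by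
          rw [transferOp_const_mul]
          ring
  calc transferOp X g n f x
      ≤ K ^ 4 * E * (Real.exp (n * (pressure X g - pressure X g')) *
          Real.exp (n * pressure X g')) := by
        rwa [← Real.exp_add, ← mul_add, sub_add_cancel]
    _ = K ^ 4 * Real.exp (n * (pressure X g - pressure X g')) *
          (E * Real.exp (n * pressure X g')) := by ring
    _ ≤ K ^ 4 * Real.exp (n * (pressure X g - pressure X g')) *
          (K ^ 6 * transferOp X g' n f x) := by gcongr
    _ = _ := by ring

theorem transferOp_mul_one_le_pow (hX : IsTransitiveMarkov m R X) {n : ℕ} {r : ℝ} (hr : 0 ≤ r)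
    (h : ∀ l, ∀ x ∈ X, transferOp X g₁ n (transferOp X g₁ l 1) x ≤
      r * transferOp X g n (transferOp X g₁ l 1) x) (k : ℕ) :
    ∀ x ∈ X, transferOp X g₁ (k * n) 1 x ≤ r ^ k * transferOp X g (k * n) 1 x := by
  induction k with
  | zero =>
    intro x hx
    simp [transferOp_zero_apply _ _ hx]
  | succ k ih =>
    intro x hx
    rw [add_one_mul, transferOp_add hX.shift_mem, transferOp_add hX.shift_mem]
    calc transferOp X g₁ n (transferOp X g₁ (k * n) 1) x
        ≤ r * transferOp X g n (transferOp X g₁ (k * n) 1) x := h _ x hx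
      _ ≤ r * transferOp X g n (fun y => r ^ k * transferOp X g (k * n) 1 y) x := by
          gcongr
          exact transferOp_mono g n ih x
      _ = r ^ (k + 1) * transferOp X g n (transferOp X g (k * n) 1) x := by
          rw [transferOp_const_mul]
          ring

theorem exp_mul_pressure_le (hX : IsTransitiveMarkov m R X) (hg : IsBowen g C D)
    (hg₁ : IsBowen g₁ C D) {n : ℕ} {r : ℝ}
    (h : ∀ l, ∀ x ∈ X, transferOp X g₁ n (transferOp X g₁ l 1) x ≤
      r * transferOp X g n (transferOp X g₁ l 1) x) :
    Real.exp (n * pressure X g₁) ≤ r * Real.exp (n * pressure X g) := by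
  obtain ⟨x, hx⟩ := hX.nonempty
  have hK := zero_lt_one.trans_le (hg.one_le_linkConst R)
  have hr : 0 ≤ r := by
    have hpos := (hX.transferOp_one_pos hg₁ (0 + n) hx)
    rw [transferOp_add hX.shift_mem] at hpos
    refine (pos_of_mul_pos_left (hpos.trans_le (h 0 x hx)) ?_).le
    exact transferOp_nonneg g n (fun y _ => transferOp_nonneg g₁ 0 (fun _ _ => zero_le_one) y) x
  refine le_of_forall_pow_le_mul_pow (c := linkConst R C D ^ 5) (Real.exp_pos _) (by positivity)
    fun k => ?_
  have hupper := hX.transferOp_one_le_exp hg (k * n) x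
  have hlower := hX.exp_le_transferOp_one hg₁ (k * n) hx
  rw [Nat.cast_mul, mul_assoc, Real.exp_nat_mul] at hupper hlower
  calc Real.exp (n * pressure X g₁) ^ k
      ≤ linkConst R C D ^ 3 * transferOp X g₁ (k * n) 1 x := hlower
    _ ≤ linkConst R C D ^ 3 *
          (r ^ k * (linkConst R C D ^ 2 * Real.exp (n * pressure X g) ^ k)) := by
        gcongr
        refine (hX.transferOp_mul_one_le_pow hr h k x hx).trans ?_
        gcongr
    _ = _ := by ring

end IsTransitiveMarkov

theorem transferOp_le_of_exp_le {X : Set Seq} {φ f : Seq → ℝ} {C D α t κ u A E : ℝ} {n : ℕ}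
    (hφ : IsBowen φ C D) (hn : 0 < n)
    (h : ∀ s ≥ -(C + |α|),
      Real.exp s ≤ A - κ * Real.exp (-(t * s)) + E * Real.exp (u * s))
    (hf : ∀ x ∈ X, 0 ≤ f x) (q : ℝ) (x : Seq) :
    transferOp X (fun y => (q + 1 / n) * φ y) n f x ≤ Real.exp α *
      (A * transferOp X (fun y => q * φ y) n f x -
        κ * Real.exp (t * α) * transferOp X (fun y => (q - t / n) * φ y) n f x +
        E * Real.exp (-(u * α)) * transferOp X (fun y => (q + u / n) * φ y) n f x) := by
  have hn' : (0 : ℝ) < n := by exact_mod_cast hn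
  have hterm : ∀ S : ℝ, |S| ≤ n * C → Real.exp ((q + 1 / n) * S) ≤ Real.exp α *
      (A * Real.exp (q * S) - κ * Real.exp (t * α) * Real.exp ((q - t / n) * S) +
        E * Real.exp (-(u * α)) * Real.exp ((q + u / n) * S)) := by
    intro S hS
    have hs : -(C + |α|) ≤ S / n - α := by
      have : -C ≤ S / n := by
        rw [le_div_iff₀ hn']
        linarith [neg_le_of_abs_le hS]
      linarith [le_abs_self α]
    calc Real.exp ((q + 1 / n) * S)
        = Real.exp α * Real.exp (q * S) * Real.exp (S / n - α) := by
          simp only [← Real.exp_add]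
          ring_nf
      _ ≤ Real.exp α * Real.exp (q * S) * (A - κ * Real.exp (-(t * (S / n - α))) +
            E * Real.exp (u * (S / n - α))) := by
          gcongr
          exact h _ hs
      _ = _ := by
          have e₁ : Real.exp (t * α) * Real.exp ((q - t / n) * S) =
              Real.exp (q * S) * Real.exp (-(t * (S / n - α))) := by
            simp only [← Real.exp_add]
            ring_nf
          have e₂ : Real.exp (-(u * α)) * Real.exp ((q + u / n) * S) =
              Real.exp (q * S) * Real.exp (u * (S / n - α)) := by
            simp only [← Real.exp_add]
            ring_nf
          rw [mul_assoc κ, e₁, mul_assoc E, e₂]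
          ring
  simp only [transferOp, birkhoffSum_const_mul, Finset.mul_sum, ← Finset.sum_sub_distrib,
    ← Finset.sum_add_distrib]
  refine Finset.sum_le_sum fun y hy => ?_
  have := mul_le_mul_of_nonneg_right (hterm _ (hφ.abs_birkhoffSum_le n y))
    (hf y (mem_preimages.1 hy).1)
  linarith

theorem exp_div_mul_le_of_le_slope_mul {K n t α β δ T T' : ℝ} (hK : 0 < K) (hn : 0 < n)
    (hT' : 0 ≤ T') (hδ : δ ≤ β * (t / n)) (h : T ≤ K * Real.exp (n * δ) * T') :
    Real.exp (t * (α - β)) / K * T ≤ Real.exp (t * α) * T' := by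
  have hexp : n * δ ≤ t * β := by
    calc n * δ ≤ n * (β * (t / n)) := by gcongr
      _ = t * β := by field_simp
  calc Real.exp (t * (α - β)) / K * T
      ≤ Real.exp (t * (α - β)) / K * (K * Real.exp (t * β) * T') := by
        gcongr
        exact h.trans (by gcongr)
    _ = Real.exp (t * (α - β)) * Real.exp (t * β) * T' := by field_simp
    _ = Real.exp (t * α) * T' := by
        rw [← Real.exp_add]
        ring_nf

theorem exp_mul_exp_mul_le_of_le_slope_mul {K n h α ε δ T T' : ℝ} (hK : 0 ≤ K) (hn : 0 ≤ n)
    (hT' : 0 ≤ T') (hδ : δ ≤ (α + ε / 2) * h) (hTT' : T ≤ K * Real.exp (n * δ) * T') :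
    Real.exp (ε - h * n * ε) * Real.exp (-(h * n * α)) * T ≤
      K * Real.exp ε * Real.exp (-(n * (h * ε / 2))) * T' := by
  calc Real.exp (ε - h * n * ε) * Real.exp (-(h * n * α)) * T
      ≤ Real.exp (ε - h * n * ε) * Real.exp (-(h * n * α)) *
          (K * Real.exp (n * ((α + ε / 2) * h)) * T') := by
        gcongr
        exact hTT'.trans (by gcongr)
    _ = K * T' * Real.exp (ε - h * n * ε + -(h * n * α) + n * ((α + ε / 2) * h)) := by
        rw [Real.exp_add, Real.exp_add]
        ring
    _ = K * T' * Real.exp (ε + -(n * (h * ε / 2))) := by ring_nf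
    _ = _ := by
        rw [Real.exp_add]
        ring

theorem transferOp_le_mul_of_kink {X : Set Seq} {φ f : Seq → ℝ} {P : ℝ → ℝ}
    {C D q₀ α β t κ ε h A K : ℝ} {n : ℕ} {x : Seq} (hφ : IsBowen φ C D) (hn : 0 < n)
    (ht : t ∈ Icc (0 : ℝ) n) (hκ : 0 ≤ κ) (hh : h ∈ Icc (0 : ℝ) 1) (hK : 0 < K)
    (hf : ∀ x ∈ X, 0 ≤ f x)
    (hcomb : ∀ s ≥ -(C + |α|), Real.exp s ≤ A - κ * Real.exp (-(t * s)) +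
      Real.exp (ε - h * n * ε) * Real.exp (h * n * s))
    (hcomp : ∀ q q', |q - q₀| ≤ 1 → |q' - q₀| ≤ 1 →
      transferOp X (fun y => q * φ y) n f x ≤
        K * Real.exp (n * (P q - P q')) * transferOp X (fun y => q' * φ y) n f x)
    (hleft : P q₀ - P (q₀ - t / n) ≤ β * (t / n))
    (hright : P (q₀ + h) - P q₀ ≤ (α + ε / 2) * h) :
    transferOp X (fun y => (q₀ + 1 / n) * φ y) n f x ≤ Real.exp α *
      ((A - κ * (Real.exp (t * (α - β)) / K) + K * Real.exp ε * Real.exp (-(n * (h * ε / 2)))) *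
        transferOp X (fun y => q₀ * φ y) n f x) := by
  have hn' : (0 : ℝ) < n := by exact_mod_cast hn
  have hT : ∀ q : ℝ, 0 ≤ transferOp X (fun y => q * φ y) n f x := fun q =>
    transferOp_nonneg _ n hf x
  have htn : |q₀ - t / n - q₀| ≤ 1 := by
    rw [sub_sub_cancel_left, abs_neg, abs_of_nonneg (div_nonneg ht.1 hn'.le), div_le_one hn']
    exact ht.2
  have hhq : |q₀ + h - q₀| ≤ 1 := by
    rw [add_sub_cancel_left, abs_of_nonneg hh.1]
    exact hh.2
  have hmiddle := exp_div_mul_le_of_le_slope_mul (α := α) hK hn' (hT _) hleft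
    (hcomp q₀ _ (by simp) htn)
  have hlast := exp_mul_exp_mul_le_of_le_slope_mul hK.le hn'.le (hT _) hright
    (hcomp _ q₀ hhq (by simp))
  have hsum := transferOp_le_of_exp_le hφ hn hcomb hf q₀ x
  rw [mul_div_cancel_right₀ h hn'.ne'] at hsum
  refine hsum.trans ?_
  gcongr
  linarith [mul_le_mul_of_nonneg_left hmiddle hκ]

namespace IsTransitiveMarkov

variable {m R : ℕ} {X : Set Seq} {φ : Seq → ℝ} {C D q₀ α β : ℝ}

theorem false_of_kink (hX : IsTransitiveMarkov m R X) (hφ : IsBowen φ C D) (hβα : β < α)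
    {P : ℝ → ℝ} (hP : ∀ q, P q = pressure X fun x => q * φ x)
    (hright : ∀ h > 0, α * h ≤ P (q₀ + h) - P q₀)
    (hleft : ∀ h > 0, P q₀ - P (q₀ - h) ≤ β * h)
    (hsmall : ∀ ε > 0, ∃ h ∈ Ioc (0 : ℝ) 1, P (q₀ + h) - P q₀ ≤ (α + ε) * h) : False := by
  have hg : ∀ q : ℝ, |q - q₀| ≤ 1 →
      IsBowen (fun x => q * φ x) ((|q₀| + 1) * C) ((|q₀| + 1) * D) := fun q hq =>
    hφ.const_mul_of_abs_le (by linarith [abs_sub_abs_le_abs_sub q q₀])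
  set K := linkConst R ((|q₀| + 1) * C) ((|q₀| + 1) * D) ^ 10
  have hK : 1 ≤ K := one_le_pow₀ ((hg q₀ (by simp)).one_le_linkConst R)
  obtain ⟨t, ht, κ, hκ, ε, hε, A, hA, hcomb⟩ :=
    exists_exp_le_combination (C + |α|) (sub_pos.2 hβα) hK
  obtain ⟨h, ⟨hh0, hh1⟩, hPh⟩ := hsmall (ε / 2) (half_pos hε)
  set r : ℕ → ℝ := fun n => A - κ * (Real.exp (t * (α - β)) / K) +
    K * Real.exp ε * Real.exp (-(n * (h * ε / 2)))
  have hr : Tendsto r atTop (𝓝 (A - κ * (Real.exp (t * (α - β)) / K) + K * Real.exp ε * 0)) := by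
    refine (Tendsto.const_mul _ (Real.tendsto_exp_neg_atTop_nhds_zero.comp ?_)).const_add _
    exact tendsto_natCast_atTop_atTop.atTop_mul_const (by positivity)
  have hcast := tendsto_natCast_atTop_atTop (R := ℝ)
  obtain ⟨n, hrn, htn, hhn, hn⟩ :=
    ((hr.eventually_lt_const (by linarith : _ < (1 : ℝ))).and ((hcast.eventually_ge_atTop t).and
      ((hcast.eventually_ge_atTop (1 / h)).and (eventually_gt_atTop 0)))).exists
  have hn' : (0 : ℝ) < n := by exact_mod_cast hn
  have hn1 : |q₀ + 1 / n - q₀| ≤ 1 := by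
    rw [add_sub_cancel_left, abs_of_pos (by positivity), div_le_one hn']
    exact_mod_cast hn
  have hgrowth := hX.exp_mul_pressure_le (hg q₀ (by simp)) (hg _ hn1) fun l x hx =>
    (transferOp_le_mul_of_kink hφ hn ⟨ht.le, htn⟩ hκ ⟨hh0.le, hh1⟩ (by positivity)
      (fun y _ => transferOp_nonneg _ l (fun _ _ => zero_le_one) y)
      (hcomb (h * n) (by rwa [ge_iff_le, ← div_le_iff₀' hh0]))
      (fun q q' hq hq' => hP q ▸ hP q' ▸
        hX.transferOp_transferOp_one_le (hg q hq) (hg q' hq') (hg _ hn1) n l hx)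
      (hleft _ (by positivity)) hPh).trans_eq (mul_assoc _ _ _).symm
  rw [← hP, ← hP] at hgrowth
  have hlt : Real.exp (n * P (q₀ + 1 / n)) < Real.exp (α + n * P q₀) := by
    refine hgrowth.trans_lt ?_
    rw [Real.exp_add]
    gcongr
    exact mul_lt_of_lt_one_right (Real.exp_pos α) hrn
  have hslope := hright (1 / n) (by positivity)
  rw [mul_one_div, div_le_iff₀ hn'] at hslope
  linarith [Real.exp_lt_exp.1 hlt]

theorem differentiable_pressure (hX : IsTransitiveMarkov m R X) (hφ : IsBowen φ C D) :
    Differentiable ℝ fun q : ℝ => pressure X fun x => q * φ x := by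
  intro q₀
  by_contra hdiff
  obtain ⟨α, β, hβα, hright, hleft, hsmall⟩ :=
    exists_kink_of_not_differentiableAt (hX.convexOn_pressure hφ) hdiff
  exact hX.false_of_kink hφ hβα (fun _ => rfl) hright hleft hsmall

end IsTransitiveMarkov

/-! ### Transitive pieces of subshifts of finite type -/

theorem pref_iterate_shift_concat_pref {i j k m : ℕ} {x y : Seq}
    (h : pref m (shift^[k] y) = pref m x) (hij : j + i ≤ k + m) :
    pref j (shift^[i] (concat (pref k y) x)) = pref j (shift^[i] y) :=
  pref_iterate_shift_eq (pref_eq_pref_of_le hij (pref_add_concat_pref h))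

theorem iterate_shift_add_concat (l : ℕ) {k : ℕ} (w : Word k) (x : Seq) :
    shift^[l + k] (concat w x) = shift^[l] x := by
  rw [Function.iterate_add_apply, iterate_shift_concat]

theorem concat_mem_sft {n m k : ℕ} {A : Set (Word n)} (hnm : n ≤ m + 1) {x y : Seq}
    (hy : y ∈ sft A) (hx : x ∈ sft A) (h : pref m (shift^[k] y) = pref m x) :
    concat (pref k y) x ∈ sft A := by
  intro j
  rcases lt_or_ge j k with hj | hj
  · rw [pref_iterate_shift_concat_pref h (by omega)]
    exact hy j
  · obtain ⟨l, rfl⟩ := Nat.exists_eq_add_of_le' hj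
    rw [iterate_shift_add_concat]
    exact hx l

theorem isTransitiveMarkov_univ : IsTransitiveMarkov 0 0 (univ : Set Seq) :=
  ⟨univ_nonempty, fun _ _ => mem_univ _, fun _ _ _ _ _ _ => mem_univ _,
    fun x _ _ _ => ⟨0, le_rfl, x, mem_univ _, Subsingleton.elim _ _, rfl⟩⟩

/-- The length of a link only depends on the two words of length `m` that it joins, and there are
finitely many such pairs. -/
theorem exists_isTransitiveMarkov_of_exists_link {m : ℕ} {X : Set Seq} (hne : X.Nonempty)
    (hshift : ∀ x ∈ X, shift x ∈ X)
    (hconcat : ∀ n : ℕ, ∀ y ∈ X, ∀ x ∈ X, pref m (shift^[n] y) = pref m x →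
      concat (pref n y) x ∈ X)
    (hlink : ∀ x ∈ X, ∀ y ∈ X, ∃ r, ∃ z ∈ X, pref m z = pref m y ∧ shift^[r] z = x) :
    ∃ R, IsTransitiveMarkov m R X := by
  have hpair : ∀ p : Word m × Word m, ∃ r, ∀ x ∈ X, ∀ y ∈ X, pref m x = p.1 → pref m y = p.2 →
      ∃ z ∈ X, pref m z = pref m y ∧ shift^[r] z = x := by
    intro p
    by_cases hp : ∃ x ∈ X, ∃ y ∈ X, pref m x = p.1 ∧ pref m y = p.2
    · obtain ⟨x₀, hx₀, y₀, hy₀, hx₀p, hy₀p⟩ := hp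
      obtain ⟨r, z, hz, hzy, hzx⟩ := hlink x₀ hx₀ y₀ hy₀
      refine ⟨r, fun x hx y _ hxp hyp => ?_⟩
      have hzx' : pref m (shift^[r] z) = pref m x := by rw [hzx, hx₀p, hxp]
      refine ⟨concat (pref r z) x, hconcat r z hz x hx hzx', ?_, iterate_shift_concat _ _⟩
      rw [pref_eq_pref_of_le (Nat.le_add_left m r) (pref_add_concat_pref hzx'), hzy, hy₀p, hyp]
    · exact ⟨0, fun x hx y hy hxp hyp => absurd ⟨x, hx, y, hy, hxp, hyp⟩ hp⟩
  choose r hr using hpair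
  refine ⟨Finset.univ.sup r, hne, hshift, hconcat, fun x hx y hy => ?_⟩
  exact ⟨r (pref m x, pref m y), Finset.le_sup (Finset.mem_univ _), hr _ x hx y hy rfl rfl⟩

section Piece

variable {n : ℕ} {A : Set (Word n)}

/-- The class of the words that communicate with `u`: it is irreducible as soon as `u` communicates
with itself, and empty otherwise. -/
def commClass (A : Set (Word n)) (u : Word (n - 1)) : Set (Word (n - 1)) :=
  {v | Relation.TransGen (Trans A) u v ∧ Relation.TransGen (Trans A) v u}

/-- The transitive piece of `sft A` that belongs to the class of `u`. -/
def piece (A : Set (Word n)) (u : Word (n - 1)) : Set Seq :=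
  sft A ∩ sft (commClass A u)

theorem isTransitivePiece_iff {X : Set Seq} : IsTransitivePiece A X ↔
    ∃ u, Relation.TransGen (Trans A) u u ∧ X = piece A u :=
  ⟨fun ⟨u, _, hu, hC, hX⟩ => ⟨u, hu, hX.trans (by rw [hC]; rfl)⟩,
    fun ⟨u, hu, hX⟩ => ⟨u, _, hu, rfl, hX⟩⟩

theorem trans_pref_shift {t : Seq} (ht : t ∈ sft A) (i : ℕ) :
    Trans A (pref (n - 1) (shift^[i] t)) (pref (n - 1) (shift^[i + 1] t)) := by
  refine ⟨_, ht i, fun j => rfl, fun j => ?_⟩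
  rw [Function.iterate_succ_apply']
  rfl

theorem transGen_pref_shift {t : Seq} (ht : t ∈ sft A) {i j : ℕ} (hij : i < j) :
    Relation.TransGen (Trans A) (pref (n - 1) (shift^[i] t)) (pref (n - 1) (shift^[j] t)) := by
  induction j, hij using Nat.le_induction with
  | base => exact .single (trans_pref_shift ht i)
  | succ j _ ih => exact ih.tail (trans_pref_shift ht j)

variable {u v : Word (n - 1)}

theorem transGen_self_of_mem_commClass (hv : v ∈ commClass A u) :
    Relation.TransGen (Trans A) u u :=
  hv.1.trans hv.2

theorem exists_trans_of_mem_commClass (hv : v ∈ commClass A u) :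
    ∃ w ∈ commClass A u, Trans A v w := by
  obtain ⟨w, hvw, hwu⟩ := Relation.TransGen.head'_iff.1 hv.2
  refine ⟨w, ⟨hv.1.tail hvw, ?_⟩, hvw⟩
  exact Relation.TransGen.trans_right hwu (transGen_self_of_mem_commClass hv)

theorem exists_mem_commClass_trans (hv : v ∈ commClass A u) :
    ∃ w ∈ commClass A u, Trans A w v := by
  obtain ⟨w, huw, hwv⟩ := Relation.TransGen.tail'_iff.1 hv.1
  refine ⟨w, ⟨?_, .head hwv hv.2⟩, hwv⟩
  exact Relation.TransGen.trans_left (transGen_self_of_mem_commClass hv) huw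

theorem exists_mem_sft_of_forall_trans (hn : 0 < n) {p : ℕ → Word (n - 1)}
    (hp : ∀ i, Trans A (p i) (p (i + 1))) :
    ∃ t ∈ sft A, ∀ i, pref (n - 1) (shift^[i] t) = p i := by
  choose a haA hpa hpa' using hp
  have hread : ∀ (j : ℕ) (hj : j < n) (i : ℕ), a i ⟨j, hj⟩ = a (i + j) ⟨0, hn⟩ := by
    intro j
    induction j with
    | zero => exact fun _ _ => rfl
    | succ j ih =>
      intro hj i
      rw [← hpa' i ⟨j, by omega⟩, hpa (i + 1) ⟨j, by omega⟩, ih (by omega) (i + 1)]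
      congr 1
      omega
  set t : Seq := fun i => a i ⟨0, hn⟩
  have hpref : ∀ i, pref n (shift^[i] t) = a i := fun i => funext fun j => by
    rw [pref, iterate_shift_apply, add_comm, hread j j.2 i]
  refine ⟨t, fun i => hpref i ▸ haA i, fun i => funext fun j => ?_⟩
  rw [hpa i j, ← hpref i]
  rfl

theorem piece_nonempty (hn : 0 < n) (hu : Relation.TransGen (Trans A) u u) :
    (piece A u).Nonempty := by
  choose next hnext hnext' using fun v : commClass A u => exists_trans_of_mem_commClass v.2
  set p : ℕ → commClass A u := fun i => (fun v => ⟨next v, hnext v⟩)^[i] ⟨u, hu, hu⟩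
  obtain ⟨t, htA, ht⟩ := exists_mem_sft_of_forall_trans hn (p := fun i => (p i).1) fun i => by
    simp only [p, Function.iterate_succ_apply']
    exact hnext' _
  exact ⟨t, htA, fun i => ht i ▸ (p i).2⟩

theorem shift_mem_piece {t : Seq} (ht : t ∈ piece A u) : shift t ∈ piece A u :=
  ⟨fun m => ht.1 (m + 1), fun m => ht.2 (m + 1)⟩

theorem exists_mem_piece_shift_eq (hn : 0 < n) {x : Seq} (hx : x ∈ piece A u)
    (hv : v ∈ commClass A u) (hvx : Trans A v (pref (n - 1) x)) :
    ∃ z ∈ piece A u, pref (n - 1) z = v ∧ shift z = x := by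
  obtain ⟨a, ha, hva, hxa⟩ := hvx
  set z : Seq := concat (fun _ : Fin 1 => a ⟨0, hn⟩) x
  have hzx : shift z = x := iterate_shift_concat (fun _ : Fin 1 => a ⟨0, hn⟩) x
  have hzn : pref n z = a := by
    funext ⟨i, hi⟩
    rcases i with _ | i
    · simp [pref, z, concat]
    · rw [← hxa ⟨i, by omega⟩, ← hzx]
      rfl
  have hzv : pref (n - 1) z = v := by
    funext i
    rw [hva i, ← hzn]
    rfl
  refine ⟨z, ⟨fun m => ?_, fun m => ?_⟩, hzv, hzx⟩ <;> rcases m with _ | m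
  · exact hzn ▸ ha
  · rw [Function.iterate_succ_apply, hzx]
    exact hx.1 m
  · exact hzv ▸ hv
  · rw [Function.iterate_succ_apply, hzx]
    exact hx.2 m

theorem exists_mem_piece_iterate_shift_eq_of_transGen (hn : 0 < n) {x : Seq} (hx : x ∈ piece A u)
    (hv : Relation.TransGen (Trans A) u v)
    (hvx : Relation.TransGen (Trans A) v (pref (n - 1) x)) :
    ∃ r, ∃ z ∈ piece A u, pref (n - 1) z = v ∧ shift^[r] z = x := by
  have hxu := (hx.2 0).2
  induction hvx using Relation.TransGen.head_induction_on with
  | single h =>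
    obtain ⟨z, hz, hzv, hzx⟩ := exists_mem_piece_shift_eq hn hx ⟨hv, .head h hxu⟩ h
    exact ⟨1, z, hz, hzv, hzx⟩
  | head h h' ih =>
    obtain ⟨r, z, hz, rfl, hzx⟩ := ih (hv.tail h)
    obtain ⟨z', hz', hzv', rfl⟩ :=
      exists_mem_piece_shift_eq hn hz ⟨hv, .head h (h'.trans hxu)⟩ h
    exact ⟨r + 1, z', hz', hzv', hzx⟩

theorem exists_mem_piece_iterate_shift_eq (hn : 0 < n) (k : ℕ) {x : Seq} (hx : x ∈ piece A u) :
    ∃ y ∈ piece A u, shift^[k] y = x := by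
  induction k with
  | zero => exact ⟨x, hx, rfl⟩
  | succ k ih =>
    obtain ⟨y, hy, hyx⟩ := ih
    obtain ⟨v, hv, hvy⟩ := exists_mem_commClass_trans (hy.2 0)
    obtain ⟨z, hz, -, rfl⟩ := exists_mem_piece_shift_eq hn hy hv hvy
    exact ⟨z, hz, hyx⟩

theorem exists_isTransitiveMarkov_piece (hn : 0 < n) (hu : Relation.TransGen (Trans A) u u) :
    ∃ R, IsTransitiveMarkov (n - 1) R (piece A u) := by
  refine exists_isTransitiveMarkov_of_exists_link (piece_nonempty hn hu)
    (fun x => shift_mem_piece) (fun k y hy x hx h => ?_) fun x hx y hy => ?_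
  · exact ⟨concat_mem_sft (by omega) hy.1 hx.1 h, concat_mem_sft (by omega) hy.2 hx.2 h⟩
  · exact exists_mem_piece_iterate_shift_eq_of_transGen hn hx (hy.2 0).1
      ((hy.2 0).2.trans (hx.2 0).1)

end Piece

/-! ### Free concatenations of safe words -/

section SafeWords

variable {n M : ℕ} {A : Set (Word n)}

/-- The words `w` of length `M` that guarantee admissibility: every word of length `n` in which `w`
occurs belongs to `A`. The words of length `n` are represented by the sequences that they begin. -/
def safeWords (A : Set (Word n)) (M : ℕ) : Set (Word M) :=
  {w | ∀ (t : Seq) (j : ℕ), j + M ≤ n → pref M (shift^[j] t) = w → pref n t ∈ A}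

/-- The infinite concatenations of words from `W`. -/
def freeShift (W : Set (Word M)) : Set Seq :=
  {t | ∀ j, pref M (shift^[j * M] t) ∈ W}

theorem concat_mem_freeShift {W : Set (Word M)} {w : Word M} (hw : w ∈ W) {x : Seq}
    (hx : x ∈ freeShift W) : concat w x ∈ freeShift W := by
  rintro (_ | j)
  · rw [zero_mul, Function.iterate_zero, id, pref_concat]
    exact hw
  · rw [add_mul, one_mul, iterate_shift_add_concat]
    exact hx j

theorem freeShift_nonempty {W : Set (Word M)} (hW : W.Nonempty) : (freeShift W).Nonempty := by
  obtain ⟨w, hw⟩ := hW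
  rcases M.eq_zero_or_pos with rfl | hM
  · exact ⟨0, fun j => by convert hw⟩
  refine ⟨fun i => w ⟨i % M, Nat.mod_lt _ hM⟩, fun j => ?_⟩
  convert hw
  funext i
  simp [pref, iterate_shift_apply, Nat.mod_eq_of_lt i.2]

theorem pref_iterate_shift_mem_of_safe {t : Seq} {m p : ℕ}
    (h : pref M (shift^[p] t) ∈ safeWords A M) (hmp : m ≤ p) (hpm : p + M ≤ m + n) :
    pref n (shift^[m] t) ∈ A := by
  refine h (shift^[m] t) (p - m) (by omega) ?_
  rw [← Function.iterate_add_apply, Nat.sub_add_cancel hmp]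

theorem exists_le_mul_and_mul_lt_add (hM : 0 < M) (m : ℕ) : ∃ q, m ≤ q * M ∧ q * M < m + M := by
  refine ⟨(m + M - 1) / M, ?_, ?_⟩
  · have := Nat.lt_div_mul_add hM (a := m + M - 1)
    omega
  · have := Nat.div_mul_le_self (m + M - 1) M
    omega

theorem freeShift_safeWords_subset_sft (hM : 0 < M) (hMn : 2 * M ≤ n) :
    freeShift (safeWords A M) ⊆ sft A := by
  intro t ht m
  obtain ⟨q, hmq, hqm⟩ := exists_le_mul_and_mul_lt_add hM m
  exact pref_iterate_shift_mem_of_safe (ht q) hmq (by omega)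

theorem concat_freeShift_mem_sft (hM : 0 < M) (hMn : 2 * M ≤ n) {t x : Seq}
    (ht : t ∈ freeShift (safeWords A M)) (hx : x ∈ sft A) (hx0 : pref M x ∈ safeWords A M)
    (j : ℕ) : concat (pref (j * M) t) x ∈ sft A := by
  intro m
  rcases le_or_gt (j * M) m with hm | hm
  · obtain ⟨l, rfl⟩ := Nat.exists_eq_add_of_le' hm
    rw [iterate_shift_add_concat]
    exact hx l
  obtain ⟨q, hmq, hqm⟩ := exists_le_mul_and_mul_lt_add hM m
  refine pref_iterate_shift_mem_of_safe (M := M) ?_ hmq (by omega)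
  have hq : q < j + 1 := lt_of_mul_lt_mul_right (by rw [add_mul]; omega) (Nat.zero_le M)
  rcases (Nat.lt_succ_iff.1 hq).eq_or_lt with rfl | hq
  · rwa [iterate_shift_concat]
  · have : (q + 1) * M ≤ j * M := Nat.mul_le_mul_right M hq
    rw [pref_iterate_shift_concat_pref (m := 0) (Subsingleton.elim _ _) (by lia)]
    exact ht q

theorem concat_mem_sft_of_mem_freeShift (hM : 0 < M) (hMn : 2 * M ≤ n) {t y : Seq}
    (ht : t ∈ freeShift (safeWords A M)) (hy : y ∈ sft A) {k : ℕ}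
    (hyk : pref M (shift^[k] y) ∈ safeWords A M) : concat (pref (k + M) y) t ∈ sft A := by
  have hpref : ∀ {i j}, j + i ≤ k + M →
      pref j (shift^[i] (concat (pref (k + M) y) t)) = pref j (shift^[i] y) := fun hij =>
    pref_iterate_shift_concat_pref (m := 0) (Subsingleton.elim _ _) hij
  intro m
  rcases le_or_gt (n + m) (k + M) with hm | hm
  · rw [hpref hm]
    exact hy m
  rcases le_or_gt m k with hmk | hmk
  · refine pref_iterate_shift_mem_of_safe (M := M) ?_ hmk (by omega)
    rwa [hpref (by omega)]
  rcases lt_or_ge m (k + M) with hmk' | hmk'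
  · refine pref_iterate_shift_mem_of_safe (M := M) ?_ hmk'.le (by omega)
    rw [iterate_shift_concat]
    simpa only [zero_mul, Function.iterate_zero, id] using ht 0
  · obtain ⟨l, rfl⟩ := Nat.exists_eq_add_of_le' hmk'
    rw [iterate_shift_add_concat]
    exact freeShift_safeWords_subset_sft hM hMn ht l

/-- A safe word may be followed and preceded by any concatenation of safe words, so it communicates
with all of them. -/
theorem freeShift_safeWords_subset_piece (hM : 0 < M) (hMn : 2 * M ≤ n) {u : Word (n - 1)}
    {x : Seq} (hx : x ∈ piece A u) (hx0 : pref M x ∈ safeWords A M) :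
    freeShift (safeWords A M) ⊆ piece A u := by
  intro t ht
  refine ⟨freeShift_safeWords_subset_sft hM hMn ht, fun m => ⟨?_, ?_⟩⟩
  · obtain ⟨y, hy, rfl⟩ := exists_mem_piece_iterate_shift_eq (by omega) n hx
    have hpath := transGen_pref_shift (concat_mem_sft_of_mem_freeShift hM hMn ht hy.1 hx0)
      (i := 0) (j := m + (n + M)) (by omega)
    rw [pref_iterate_shift_concat_pref (m := 0) (Subsingleton.elim _ _) (by omega),
      iterate_shift_add_concat] at hpath
    exact (hy.2 0).1.trans hpath
  · have hle : m + n ≤ (m + n) * M := Nat.le_mul_of_pos_right _ hM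
    have hpath := transGen_pref_shift (concat_freeShift_mem_sft hM hMn ht hx.1 hx0 (m + n))
      (i := m) (j := (m + n) * M) (by omega)
    rw [pref_iterate_shift_concat_pref (m := 0) (Subsingleton.elim _ _) (by omega),
      iterate_shift_concat] at hpath
    exact hpath.trans (hx.2 0).2

theorem ncard_compl_safeWords_le (A : Set (Word n)) (M : ℕ) :
    (safeWords A M)ᶜ.ncard ≤ Aᶜ.ncard * (n + 1) := by
  set factor : Word n × Fin (n + 1) → Word M := fun p => pref M (shift^[p.2] (concat p.1 0))
  have hsub : (safeWords A M)ᶜ ⊆ factor '' (Aᶜ ×ˢ univ) := by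
    intro w hw
    simp only [safeWords, mem_compl_iff, Set.mem_ofPred_eq, not_forall] at hw
    obtain ⟨t, j, hj, rfl, ht⟩ := hw
    refine ⟨(pref n t, ⟨j, by omega⟩), ⟨ht, mem_univ _⟩, ?_⟩
    exact pref_iterate_shift_concat_pref (m := 0) (Subsingleton.elim _ _) (by dsimp only; omega)
  calc (safeWords A M)ᶜ.ncard ≤ (factor '' (Aᶜ ×ˢ univ)).ncard := ncard_le_ncard hsub
    _ ≤ (Aᶜ ×ˢ (univ : Set (Fin (n + 1)))).ncard := ncard_image_le
    _ = Aᶜ.ncard * (n + 1) := by rw [ncard_prod, ncard_univ, Nat.card_fin]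

end SafeWords

/-! ### The number of forbidden words -/

theorem lam_mul_two_pow {k : ℕ} (w : Word k) :
    lam w * 2 ^ k = (finFunctionFinEquiv (w ∘ Fin.rev) : Fin (2 ^ k)) := by
  rw [finFunctionFinEquiv_apply, ← Equiv.sum_comp Fin.revPerm, lam, Finset.sum_mul]
  push_cast
  refine Finset.sum_congr rfl fun i _ => ?_
  simp only [Fin.revPerm_apply, Function.comp, Fin.rev_rev, Fin.val_rev]
  have hpow : (2 : ℝ) ^ k = 2 ^ ((i : ℕ) + 1) * 2 ^ (k - ((i : ℕ) + 1)) := by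
    rw [← pow_add, Nat.add_sub_cancel' i.2]
  rw [mul_assoc, hpow, ← mul_assoc ((1 / 2 : ℝ) ^ _), ← mul_pow]
  simp

theorem lam_eq_of_forall_eq_one {k : ℕ} {w : Word k} (hw : ∀ i, w i = 1) :
    lam w = 1 - (1 / 2) ^ k := by
  have hsum := mul_neg_geom_sum (1 / 2 : ℝ) k
  simp only [lam, hw, Fin.val_one, Nat.cast_one, one_mul, pow_succ, ← Finset.sum_mul]
  rw [Fin.sum_univ_eq_sum_range (fun i => (1 / 2 : ℝ) ^ i)]
  linarith

theorem IsDyadicPrefix.lam_mem_Icc {k : ℕ} {x : ℝ} {w : Word k} (hw : IsDyadicPrefix x w) :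
    lam w ∈ Icc (x - (1 / 2) ^ k) x := by
  rcases hw with ⟨-, hle, hlt⟩ | ⟨rfl, hone⟩
  · exact ⟨by linarith, hle⟩
  · rw [lam_eq_of_forall_eq_one hone]
    exact ⟨le_rfl, sub_le_self _ (by positivity)⟩

theorem lam_mem_Icc_of_mem_forbiddenAt {k : ℕ} {x : ℝ} {w : Word k} (hw : w ∈ forbiddenAt k x) :
    lam w ∈ Icc (x - 2 * (1 / 2) ^ k) x := by
  obtain ⟨v, hv, hvw⟩ := hw
  obtain ⟨hlo, hhi⟩ := hv.lam_mem_Icc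
  have hpos : (0 : ℝ) < (1 / 2) ^ k := by positivity
  rcases hvw with ⟨-, rfl⟩ | ⟨-, h0, h1⟩ <;> constructor <;> linarith

theorem ncard_forbiddenAt_le (k : ℕ) (x : ℝ) : (forbiddenAt k x).ncard ≤ 3 := by
  set code : Word k → ℤ := fun w => ((finFunctionFinEquiv (w ∘ Fin.rev) : Fin (2 ^ k)) : ℕ)
  have hinj : Function.Injective code := by
    intro w w' h
    simp only [code, Nat.cast_inj, Fin.val_inj, EmbeddingLike.apply_eq_iff_eq] at h
    exact Fin.rev_surjective.injective_comp_right h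
  have hmaps : ∀ w ∈ forbiddenAt k x,
      code w ∈ (Finset.Icc ⌈x * 2 ^ k - 2⌉ ⌊x * 2 ^ k⌋ : Set ℤ) := by
    intro w hw
    obtain ⟨hlo, hhi⟩ := lam_mem_Icc_of_mem_forbiddenAt hw
    have hcode : (code w : ℝ) = lam w * 2 ^ k := by simp [code, lam_mul_two_pow]
    have hpow : ((1 : ℝ) / 2) ^ k * 2 ^ k = 1 := by rw [← mul_pow]; norm_num
    rw [Finset.coe_Icc, mem_Icc, Int.ceil_le, Int.le_floor, hcode]
    constructor <;> nlinarith [pow_pos (zero_lt_two' ℝ) k]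
  calc (forbiddenAt k x).ncard
      ≤ (Finset.Icc ⌈x * 2 ^ k - 2⌉ ⌊x * 2 ^ k⌋ : Set ℤ).ncard :=
        ncard_le_ncard_of_injOn code hmaps hinj.injOn (Finset.finite_toSet _)
    _ ≤ 3 := by
        rw [ncard_coe_finset, Int.card_Icc, Int.ceil_sub_ofNat]
        have := Int.floor_le_ceil (x * 2 ^ k)
        omega

theorem ncard_compl_admissible_le {ψ : ℝ → ℝ} (hψ : (zeros ψ).Finite) (k : ℕ) :
    (admissible ψ k)ᶜ.ncard ≤ 3 * (zeros ψ).ncard := by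
  classical
  have hcompl : (admissible ψ k)ᶜ = ⋃ x ∈ hψ.toFinset, forbiddenAt k x := by
    ext w
    simp [admissible]
  calc (admissible ψ k)ᶜ.ncard ≤ ∑ x ∈ hψ.toFinset, (forbiddenAt k x).ncard := by
        rw [hcompl]
        exact Finset.set_ncard_biUnion_le _ _
    _ ≤ hψ.toFinset.card • 3 := Finset.sum_le_card_nsmul _ _ _ fun x _ => ncard_forbiddenAt_le k x
    _ = 3 * (zeros ψ).ncard := by rw [smul_eq_mul, mul_comm, ncard_eq_toFinset_card _ hψ]

/-! ### Comparison with the pressure of the full shift -/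

section Comparison

variable {m R n M : ℕ} {X : Set Seq} {g : Seq → ℝ} {C D : ℝ}

theorem partitionSum_mono {Y : Set Seq} (h : X ⊆ Y) (g : Seq → ℝ) (n : ℕ) :
    partitionSum X g n ≤ partitionSum Y g n := by
  classical
  refine Finset.sum_le_sum_of_subset_of_nonneg ?_ fun _ _ _ => Real.exp_nonneg _
  exact Finset.monotone_filter_right _ fun _ _ hw => hw.mono (inter_subset_inter_right _ h)

theorem IsTransitiveMarkov.pressure_le_pressure_univ (hX : IsTransitiveMarkov m R X)
    (hg : IsBowen g C D) : pressure X g ≤ pressure univ g := by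
  refine le_of_tendsto_of_tendsto' (hX.tendsto_pressureSeq hg)
    (isTransitiveMarkov_univ.tendsto_pressureSeq hg) fun n => ?_
  exact mul_le_mul_of_nonneg_left (Real.log_le_log (partitionSum_pos hX.nonempty g n)
    (partitionSum_mono (subset_univ X) g n)) (by positivity)

theorem sum_concat_le_transferOp {W : Finset (Word n)} {x : Seq}
    (hW : ∀ w ∈ W, concat w x ∈ X) (g : Seq → ℝ) {f : Seq → ℝ} (hf : ∀ y ∈ X, 0 ≤ f y) :
    ∑ w ∈ W, Real.exp (birkhoffSum shift g n (concat w x)) * f (concat w x) ≤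
      transferOp X g n f x := by
  classical
  rw [← Finset.sum_image (f := fun y => Real.exp (birkhoffSum shift g n y) * f y)
    (concat_left_injective x).injOn]
  refine Finset.sum_le_sum_of_subset_of_nonneg (Finset.image_subset_iff.2 fun w hw => ?_)
    fun y hy _ => mul_nonneg (Real.exp_nonneg _) (hf y (mem_preimages.1 hy).1)
  exact mem_preimages.2 ⟨hW w hw, iterate_shift_concat w x⟩

theorem transferOp_univ_one (g : Seq → ℝ) (n : ℕ) (x : Seq) :
    transferOp univ g n 1 x = ∑ w : Word n, Real.exp (birkhoffSum shift g n (concat w x)) := by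
  classical
  have hpre : preimages univ n x = Finset.univ.image fun w : Word n => concat w x := by
    ext y
    rw [mem_preimages, Finset.mem_image]
    refine ⟨fun h => ⟨pref n y, Finset.mem_univ _, ?_⟩, ?_⟩
    · rw [← h.2, concat_pref_iterate_shift]
    · rintro ⟨w, -, rfl⟩
      exact ⟨mem_univ _, iterate_shift_concat w x⟩
  rw [transferOp_one, hpre, Finset.sum_image (concat_left_injective x).injOn]

theorem exists_ne_shift_eq (x : Seq) : ∃ y ≠ x, shift y = shift x := by
  set w : Word 1 := fun _ => x 0 + 1
  refine ⟨concat w (shift x), fun h => ?_, iterate_shift_concat w (shift x)⟩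
  have hne : ∀ a : Fin 2, a + 1 ≠ a := by decide
  exact hne (x 0) (congrFun h 0)

theorem exp_mul_add_exp_mul_le_transferOp {y z : Seq} (hne : y ≠ z) (hyz : shift y = shift z)
    (g : Seq → ℝ) {f : Seq → ℝ} (hf : ∀ x, 0 ≤ f x) :
    Real.exp (g y) * f y + Real.exp (g z) * f z ≤ transferOp univ g 1 f (shift z) := by
  classical
  have hsub : ({y, z} : Finset Seq) ⊆ preimages univ 1 (shift z) := by
    intro x hx
    rcases Finset.mem_insert.1 hx with rfl | hx
    · exact mem_preimages.2 ⟨mem_univ _, hyz⟩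
    · exact mem_preimages.2 ⟨mem_univ _, by rw [Finset.mem_singleton.1 hx]; rfl⟩
  rw [transferOp]
  refine le_trans (le_of_eq ?_) (Finset.sum_le_sum_of_subset_of_nonneg hsub fun x _ _ =>
    mul_nonneg (Real.exp_nonneg _) (hf x))
  rw [Finset.sum_pair hne, birkhoffSum_one, birkhoffSum_one]

theorem linkConst_zero (C D : ℝ) : linkConst 0 C D = Real.exp D := by
  simp [linkConst]

theorem transferOp_univ_one_le_mul (hg : IsBowen g C D) (n : ℕ) (x y : Seq) :
    transferOp univ g n 1 x ≤ Real.exp D * transferOp univ g n 1 y := by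
  have h := isTransitiveMarkov_univ.partitionSum_le hg n (mem_univ y)
  rw [linkConst_zero] at h
  exact (transferOp_one_le_partitionSum univ hg n x).trans h

/-- Of the two preimages of a point, neither carries more than a fixed proportion of the mass. -/
theorem one_add_exp_mul_le_transferOp_succ (hg : IsBowen g C D) (n : ℕ) (x : Seq) :
    (1 + Real.exp (-(D + 2 * C))) * (Real.exp (g x) * transferOp univ g n 1 x) ≤
      transferOp univ g (n + 1) 1 (shift x) := by
  obtain ⟨y, hne, hyx⟩ := exists_ne_shift_eq x
  have hnonneg : ∀ z, 0 ≤ transferOp univ g n 1 z := transferOp_nonneg g n fun _ _ => zero_le_one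
  have hexp : Real.exp (-(D + 2 * C)) * Real.exp (g x) * Real.exp D ≤ Real.exp (g y) := by
    rw [← Real.exp_add, ← Real.exp_add, Real.exp_le_exp]
    linarith [le_of_abs_le (hg.bound x), neg_le_of_abs_le (hg.bound y)]
  have hy : Real.exp (-(D + 2 * C)) * (Real.exp (g x) * transferOp univ g n 1 x) ≤
      Real.exp (g y) * transferOp univ g n 1 y :=
    calc Real.exp (-(D + 2 * C)) * (Real.exp (g x) * transferOp univ g n 1 x)
        ≤ Real.exp (-(D + 2 * C)) *
            (Real.exp (g x) * (Real.exp D * transferOp univ g n 1 y)) := by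
          gcongr
          exact transferOp_univ_one_le_mul hg n x y
      _ = Real.exp (-(D + 2 * C)) * Real.exp (g x) * Real.exp D * transferOp univ g n 1 y := by
          ring
      _ ≤ Real.exp (g y) * transferOp univ g n 1 y := by
          gcongr
          exact hnonneg y
  rw [transferOp_add (fun _ _ => mem_univ _)]
  linarith [exp_mul_add_exp_mul_le_transferOp hne hyx g hnonneg]

theorem pow_mul_exp_birkhoffSum_le_transferOp (hg : IsBowen g C D) (n : ℕ) (x : Seq) :
    (1 + Real.exp (-(D + 2 * C))) ^ n * Real.exp (birkhoffSum shift g n x) ≤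
      transferOp univ g n 1 (shift^[n] x) := by
  induction n with
  | zero => simp [transferOp_zero_apply]
  | succ n ih =>
    rw [Function.iterate_succ_apply', birkhoffSum_succ, Real.exp_add, pow_succ]
    refine le_trans ?_ (one_add_exp_mul_le_transferOp_succ hg n _)
    calc (1 + Real.exp (-(D + 2 * C))) ^ n * (1 + Real.exp (-(D + 2 * C))) *
          (Real.exp (birkhoffSum shift g n x) * Real.exp (g (shift^[n] x)))
        = (1 + Real.exp (-(D + 2 * C))) * (Real.exp (g (shift^[n] x)) *
            ((1 + Real.exp (-(D + 2 * C))) ^ n * Real.exp (birkhoffSum shift g n x))) := by ring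
      _ ≤ _ := by gcongr

variable {W : Finset (Word M)}

theorem pow_le_transferOp_of_freeShift_subset (hX : ∀ x ∈ X, shift x ∈ X) (hg : IsBowen g C D)
    (hWX : freeShift (W : Set (Word M)) ⊆ X) (z : Seq) (J : ℕ) {x : Seq}
    (hx : x ∈ freeShift (W : Set (Word M))) :
    (∑ w ∈ W, Real.exp (birkhoffSum shift g M (concat w z) - D)) ^ J ≤
      transferOp X g (J * M) 1 x := by
  induction J generalizing x with
  | zero => rw [zero_mul, transferOp_zero_apply g _ (hWX hx), pow_zero, Pi.one_apply]
  | succ J ih =>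
    have hmem : ∀ w ∈ W, concat w x ∈ freeShift (W : Set (Word M)) := fun w hw =>
      concat_mem_freeShift hw hx
    rw [add_mul, one_mul, transferOp_add hX, pow_succ', Finset.sum_mul]
    refine (Finset.sum_le_sum fun w hw => ?_).trans (sum_concat_le_transferOp
      (fun w hw => hWX (hmem w hw)) g fun y _ => transferOp_nonneg g _ (fun _ _ => zero_le_one) y)
    refine mul_le_mul (Real.exp_le_exp.2 ?_) (ih (hmem w hw)) (by positivity) (Real.exp_nonneg _)
    linarith [hg.birkhoffSum_le_add ((pref_concat w z).trans (pref_concat w x).symm)]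

theorem IsTransitiveMarkov.log_sum_sub_le_pressure (hX : IsTransitiveMarkov m R X)
    (hg : IsBowen g C D) (hW : W.Nonempty) (hWX : freeShift (W : Set (Word M)) ⊆ X) (z : Seq) :
    Real.log (∑ w ∈ W, Real.exp (birkhoffSum shift g M (concat w z))) - D ≤
      M * pressure X g := by
  obtain ⟨x, hx⟩ := freeShift_nonempty (W := (W : Set (Word M))) hW
  have hpos : 0 < ∑ w ∈ W, Real.exp (birkhoffSum shift g M (concat w z)) :=
    Finset.sum_pos (fun _ _ => Real.exp_pos _) hW
  have hK := zero_lt_one.trans_le (hg.one_le_linkConst R)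
  refine Real.exp_le_exp.1 (le_of_forall_pow_le_mul_pow (c := linkConst R C D ^ 2)
    (Real.exp_pos _) (by positivity) fun J => ?_)
  calc Real.exp (Real.log (∑ w ∈ W, Real.exp (birkhoffSum shift g M (concat w z))) - D) ^ J
      = (∑ w ∈ W, Real.exp (birkhoffSum shift g M (concat w z) - D)) ^ J := by
        simp only [Real.exp_sub, Real.exp_log hpos, Finset.sum_div]
    _ ≤ transferOp X g (J * M) 1 x :=
        pow_le_transferOp_of_freeShift_subset hX.shift_mem hg hWX z J hx
    _ ≤ linkConst R C D ^ 2 * Real.exp (M * pressure X g) ^ J := by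
        rw [← Real.exp_nat_mul, ← mul_assoc, ← Nat.cast_mul]
        exact hX.transferOp_one_le_exp hg (J * M) x

theorem transferOp_univ_one_div_two_le_sum (hg : IsBowen g C D) (z : Seq)
    (hW : 2 * (Wᶜ.card : ℝ) ≤ (1 + Real.exp (-(D + 2 * C))) ^ M) :
    transferOp univ g M 1 z / 2 ≤ ∑ w ∈ W, Real.exp (birkhoffSum shift g M (concat w z)) := by
  set T := transferOp univ g M 1 z
  set ρ := (1 + Real.exp (-(D + 2 * C))) ^ M
  have hρ : 0 < ρ := by positivity
  have hT : 0 ≤ T := transferOp_nonneg g M (fun _ _ => zero_le_one) z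
  have hword : ∀ w ∈ Wᶜ, Real.exp (birkhoffSum shift g M (concat w z)) ≤ T / ρ := by
    intro w _
    rw [le_div_iff₀' hρ]
    simpa only [iterate_shift_concat] using pow_mul_exp_birkhoffSum_le_transferOp hg M (concat w z)
  have hcompl : ∑ w ∈ Wᶜ, Real.exp (birkhoffSum shift g M (concat w z)) ≤ T / 2 :=
    calc ∑ w ∈ Wᶜ, Real.exp (birkhoffSum shift g M (concat w z))
        ≤ Wᶜ.card * (T / ρ) := by
          rw [← nsmul_eq_mul]
          exact Finset.sum_le_card_nsmul _ _ _ hword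
      _ ≤ ρ / 2 * (T / ρ) := by
          gcongr
          linarith
      _ = T / 2 := by field_simp
  have hsum := Finset.sum_add_sum_compl W fun w => Real.exp (birkhoffSum shift g M (concat w z))
  rw [← transferOp_univ_one] at hsum
  linarith

theorem IsTransitiveMarkov.mul_pressure_univ_le (hX : IsTransitiveMarkov m R X)
    (hg : IsBowen g C D) (hWX : freeShift (W : Set (Word M)) ⊆ X)
    (hW : 2 * (Wᶜ.card : ℝ) ≤ (1 + Real.exp (-(D + 2 * C))) ^ M) :
    M * pressure univ g ≤ M * pressure X g + (4 * D + Real.log 2) := by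
  have hhalf := transferOp_univ_one_div_two_le_sum hg 0 hW
  have hTpos := isTransitiveMarkov_univ.transferOp_one_pos hg M (mem_univ 0)
  have hWne : W.Nonempty := by
    rw [Finset.nonempty_iff_ne_empty]
    rintro rfl
    rw [Finset.sum_empty] at hhalf
    linarith
  have hlogT : M * pressure univ g ≤ 3 * D + Real.log (transferOp univ g M 1 0) := by
    have hT := isTransitiveMarkov_univ.exp_le_transferOp_one hg M (mem_univ 0)
    rw [linkConst_zero, ← Real.exp_nat_mul] at hT
    rw [← Real.exp_le_exp, Real.exp_add, Real.exp_log hTpos]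
    exact_mod_cast hT
  have hlog := Real.log_le_log (by positivity) hhalf
  rw [Real.log_div hTpos.ne' two_ne_zero] at hlog
  linarith [hX.log_sum_sub_le_pressure hg hWne hWX 0]

end Comparison

/-! ### Box dimension and the number of words -/

theorem ncard_image_pref_add_le {X : Set Seq} (hX : ∀ x ∈ X, shift x ∈ X) (m n : ℕ) :
    (pref (m + n) '' X).ncard ≤ (pref m '' X).ncard * (pref n '' X).ncard := by
  have hsub : (Fin.appendEquiv m n).symm '' (pref (m + n) '' X) ⊆
      (pref m '' X) ×ˢ (pref n '' X) := by
    rintro _ ⟨_, ⟨x, hx, rfl⟩, rfl⟩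
    refine ⟨⟨x, hx, rfl⟩, ⟨shift^[m] x, iterate_shift_mem hX m hx, ?_⟩⟩
    funext i
    simp [pref, iterate_shift_apply, Fin.appendEquiv, add_comm]
  calc (pref (m + n) '' X).ncard
      = ((Fin.appendEquiv m n).symm '' (pref (m + n) '' X)).ncard :=
        (ncard_image_of_injective _ (Equiv.injective _)).symm
    _ ≤ _ := ncard_le_ncard hsub
    _ = _ := ncard_prod

theorem ncard_image_pref_mul_le {X : Set Seq} (hX : ∀ x ∈ X, shift x ∈ X) (j m : ℕ) :
    (pref (j * m) '' X).ncard ≤ (pref m '' X).ncard ^ j := by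
  induction j with
  | zero =>
    rw [zero_mul, pow_zero]
    exact ncard_le_one_of_subsingleton _
  | succ j ih =>
    rw [add_mul, one_mul, pow_succ]
    exact (ncard_image_pref_add_le hX _ _).trans (Nat.mul_le_mul_right _ ih)

theorem ncard_mul_le_ncard_image_pref_freeShift {m : ℕ} (W : Set (Word m)) (n : ℕ) :
    W.ncard * (pref n '' freeShift W).ncard ≤ (pref (m + n) '' freeShift W).ncard := by
  have hsub : W ×ˢ (pref n '' freeShift W) ⊆
      (Fin.appendEquiv m n).symm '' (pref (m + n) '' freeShift W) := by
    rintro ⟨w, _⟩ ⟨hw, x, hx, rfl⟩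
    refine ⟨_, ⟨concat w x, concat_mem_freeShift hw hx, rfl⟩, Prod.ext ?_ ?_⟩
    · funext i
      simp [pref, concat, Fin.appendEquiv]
    · funext i
      simp [pref, concat, Fin.appendEquiv]
  calc W.ncard * (pref n '' freeShift W).ncard
      = (W ×ˢ (pref n '' freeShift W)).ncard := ncard_prod.symm
    _ ≤ _ := ncard_le_ncard hsub
    _ ≤ _ := ncard_image_le

theorem ncard_pow_le_ncard_image_pref_freeShift {m : ℕ} {W : Set (Word m)} (hW : W.Nonempty)
    (j : ℕ) : W.ncard ^ j ≤ (pref (j * m) '' freeShift W).ncard := by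
  induction j with
  | zero => exact ((freeShift_nonempty hW).image _).ncard_pos
  | succ j ih =>
    rw [add_mul, one_mul, add_comm (j * m), pow_succ']
    exact (Nat.mul_le_mul_left _ ih).trans (ncard_mul_le_ncard_image_pref_freeShift W _)

theorem pref_eq_pref_iff_edist_le {n : ℕ} {x y : Seq} :
    pref n x = pref n y ↔ edist x y ≤ ((1 / 2) ^ n : ℝ≥0) := by
  rw [pref_eq_pref_iff_dist_le, edist_le_coe, ← NNReal.coe_le_coe, coe_nndist]
  norm_num

theorem coveringNumber_le_ncard_image_pref (X : Set Seq) {n : ℕ} {δ : ℝ≥0}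
    (hδ : (1 / 2) ^ n ≤ δ) : Metric.coveringNumber δ X ≤ (pref n '' X).ncard := by
  obtain ⟨S, hSX, hS⟩ := exists_subset_bijOn X (pref n)
  have hcover : Metric.IsCover δ X S := by
    intro x hx
    obtain ⟨y, hy, hyx⟩ := hS.surjOn (mem_image_of_mem _ hx)
    exact ⟨y, hy, (pref_eq_pref_iff_edist_le.1 hyx.symm).trans (by exact_mod_cast hδ)⟩
  rw [(toFinite _).cast_ncard_eq, ← hS.image_eq, hS.injOn.encard_image]
  exact hcover.coveringNumber_le_encard hSX

theorem ncard_image_pref_le_coveringNumber (X : Set Seq) (n : ℕ) :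
    (pref n '' X).ncard ≤ Metric.coveringNumber ((1 / 2) ^ n) X := by
  refine le_iInf fun S => le_iInf fun _ => le_iInf fun hcover => ?_
  rw [(toFinite _).cast_ncard_eq]
  refine (encard_le_encard ?_).trans (encard_image_le (pref n) S)
  rintro _ ⟨x, hx, rfl⟩
  obtain ⟨y, hy, hxy⟩ := hcover hx
  exact ⟨y, hy, (pref_eq_pref_iff_edist_le.2 hxy).symm⟩

theorem log_ennreal_natCast {a : ℕ} (ha : a ≠ 0) :
    ENNReal.log (a : ℝ≥0∞) = (Real.log a : ℝ) := by
  exact_mod_cast ENNReal.log_of_nnreal (Nat.cast_ne_zero.2 ha)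

theorem log_half_pow (n : ℕ) : Real.log ((1 / 2) ^ n) = -(n * Real.log 2) := by
  rw [Real.log_pow, one_div, Real.log_inv, mul_neg]

section Dimension

variable {M : ℕ} {X : Set Seq}

theorem log_coveringNumber_le (hX : ∀ x ∈ X, shift x ∈ X) (hne : X.Nonempty) (hM : 0 < M)
    {δ : ℝ≥0} (hδ0 : 0 < δ) (hδ1 : δ ≤ 1) :
    ENNReal.log (Metric.coveringNumber δ X : ℝ≥0∞) ≤
      ((-Real.log δ / (M * Real.log 2) + 1) * Real.log (pref M '' X).ncard : ℝ) := by
  set N := (pref M '' X).ncard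
  have hN : 0 < N := (hne.image _).ncard_pos
  have hδ0' : (0 : ℝ) < δ := hδ0
  set a : ℝ := -Real.log δ / (M * Real.log 2) with ha
  have ha0 : 0 ≤ a :=
    div_nonneg (neg_nonneg.2 (Real.log_nonpos δ.coe_nonneg hδ1)) (by positivity)
  have hpow : (1 / 2) ^ ((⌊a⌋₊ + 1) * M) ≤ δ := by
    rw [← NNReal.coe_le_coe, ← Real.log_le_log_iff (by positivity) hδ0']
    push_cast
    rw [log_half_pow, neg_le, Nat.cast_mul, mul_assoc,
      ← div_le_iff₀ (mul_pos (by exact_mod_cast hM) (Real.log_pos one_lt_two)), ← ha]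
    exact_mod_cast (Nat.lt_floor_add_one a).le
  have hcover : Metric.coveringNumber δ X ≤ (N ^ (⌊a⌋₊ + 1) : ℕ) :=
    (coveringNumber_le_ncard_image_pref X hpow).trans
      (by exact_mod_cast ncard_image_pref_mul_le hX _ M)
  calc ENNReal.log (Metric.coveringNumber δ X : ℝ≥0∞)
      ≤ ENNReal.log ((N ^ (⌊a⌋₊ + 1) : ℕ) : ℝ≥0∞) :=
        ENNReal.log_le_log (by exact_mod_cast hcover)
    _ = ((⌊a⌋₊ + 1 : ℕ) * Real.log N : ℝ) := by
        rw [log_ennreal_natCast (by positivity), Nat.cast_pow, Real.log_pow]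
    _ ≤ ((a + 1) * Real.log N : ℝ) := by
        rw [EReal.coe_le_coe_iff, Nat.cast_add_one]
        gcongr
        exact Nat.floor_le ha0

theorem upperBoxDim_le (hX : ∀ x ∈ X, shift x ∈ X) (hne : X.Nonempty) (hM : 0 < M) :
    upperBoxDim X ≤ (Real.log (pref M '' X).ncard / (M * Real.log 2) : ℝ) := by
  set N := (pref M '' X).ncard
  refine EReal.le_of_forall_lt_iff_le.1 fun v hv => ?_
  rw [EReal.coe_lt_coe_iff, ← sub_pos] at hv
  have hlog : Tendsto (fun δ : ℝ≥0 => -Real.log δ) (𝓝[>] 0) atTop :=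
    tendsto_neg_atBot_atTop.comp (Real.tendsto_log_nhdsGT_zero.comp
      (NNReal.continuous_coe.tendsto' 0 0 rfl |>.inf (tendsto_principal_principal.2
        fun δ (hδ : 0 < δ) => NNReal.coe_pos.2 hδ)))
  refine limsup_le_of_le (by isBoundedDefault) ?_
  filter_upwards [hlog.eventually_gt_atTop 0, Ioc_mem_nhdsGT one_pos,
    (hlog.const_mul_atTop hv).eventually_ge_atTop (Real.log N)] with δ hL hδ hv
  rw [EReal.div_le_iff_le_mul (by exact_mod_cast hL) (EReal.coe_ne_top _)]
  refine (log_coveringNumber_le hX hne hM hδ.1 hδ.2).trans ?_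
  norm_cast
  linear_combination hv

theorem le_upperBoxDim {W : Set (Word M)} (hM : 0 < M) (hW : W.Nonempty)
    (hWX : freeShift W ⊆ X) :
    (Real.log W.ncard / (M * Real.log 2) : ℝ) ≤ upperBoxDim X := by
  have hWcard : 0 < W.ncard := hW.ncard_pos
  have hscale : Tendsto (fun J : ℕ => (1 / 2 : ℝ≥0) ^ (J * M)) atTop (𝓝[>] 0) := by
    refine tendsto_nhdsWithin_iff.2 ⟨?_, Eventually.of_forall fun J => by
      simp only [mem_Ioi]; positivity⟩
    exact (tendsto_pow_atTop_nhds_zero_of_lt_one (by positivity) one_half_lt_one).comp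
      (tendsto_id.atTop_mul_const' hM)
  refine le_limsup_of_frequently_le (hscale.frequently (Eventually.frequently ?_))
    (by isBoundedDefault)
  filter_upwards [eventually_gt_atTop 0] with J hJ
  have hJM : (0 : ℝ) < (J * M : ℕ) * Real.log 2 :=
    mul_pos (by exact_mod_cast Nat.mul_pos hJ hM) (Real.log_pos one_lt_two)
  have hcover : (W.ncard ^ J : ℕ) ≤ Metric.coveringNumber ((1 / 2) ^ (J * M)) X := by
    refine le_trans ?_ (ncard_image_pref_le_coveringNumber X (J * M))
    exact_mod_cast (ncard_pow_le_ncard_image_pref_freeShift hW J).trans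
      (ncard_le_ncard (image_mono hWX))
  have hlog : -Real.log (((1 / 2 : ℝ≥0) ^ (J * M) : ℝ≥0) : ℝ) = (J * M : ℕ) * Real.log 2 := by
    push_cast
    rw [log_half_pow, neg_neg, Nat.cast_mul]
  rw [hlog, EReal.le_div_iff_mul_le (by exact_mod_cast hJM) (EReal.coe_ne_top _)]
  calc _ = ((J * Real.log W.ncard : ℝ) : EReal) := by
        rw [← EReal.coe_mul]
        congr 1
        push_cast at hJM ⊢
        have : (M : ℝ) ≠ 0 := by positivity
        field_simp
    _ = ENNReal.log ((W.ncard ^ J : ℕ) : ℝ≥0∞) := by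
        rw [log_ennreal_natCast (by positivity), Nat.cast_pow, Real.log_pow]
    _ ≤ _ := ENNReal.log_le_log (by exact_mod_cast hcover)

end Dimension

/-- Otherwise the piece would have fewer words of length `M` than the free concatenations of safe
words have. -/
theorem exists_pref_mem_safeWords {n M : ℕ} {A : Set (Word n)} {u : Word (n - 1)} (hM : 0 < M)
    (hMn : 2 * M ≤ n) (hu : Relation.TransGen (Trans A) u u)
    (hdim : upperBoxDim (piece A u) = upperBoxDim (sft A))
    (hcard : 2 * (safeWords A M)ᶜ.ncard < 2 ^ M) : ∃ x ∈ piece A u, pref M x ∈ safeWords A M := by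
  by_contra! hnone
  have hne : (piece A u).Nonempty := piece_nonempty (by omega) hu
  have hpiece : (pref M '' piece A u).ncard ≤ (safeWords A M)ᶜ.ncard :=
    ncard_le_ncard (image_subset_iff.2 hnone)
  have htotal : (safeWords A M).ncard + (safeWords A M)ᶜ.ncard = 2 ^ M := by
    rw [ncard_add_ncard_compl, Nat.card_fun, Nat.card_fin, Nat.card_fin]
  have hle := (le_upperBoxDim hM (nonempty_of_ncard_ne_zero (by omega))
    (freeShift_safeWords_subset_sft hM hMn)).trans (hdim.symm.trans_le
      (upperBoxDim_le (fun _ => shift_mem_piece) hne hM))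
  rw [EReal.coe_le_coe_iff, div_le_div_iff_of_pos_right
    (mul_pos (by exact_mod_cast hM) (Real.log_pos one_lt_two)),
    Real.log_le_log_iff (by exact_mod_cast (by omega : 0 < (safeWords A M).ncard))
      (by exact_mod_cast (hne.image _).ncard_pos), Nat.cast_le] at hle
  omega

/-! ### Convergence of the pressures -/

theorem eventually_ncard_compl_admissible_le {ψ : ℝ → ℝ} (hψ : (zeros ψ).Finite) {r : ℝ}
    (hr : 1 < r) : ∀ᶠ k in atTop, ((admissible ψ k)ᶜ.ncard : ℝ) ≤ r ^ k := by
  filter_upwards [(tendsto_pow_atTop_atTop_of_one_lt hr).eventually_ge_atTop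
    ((3 * (zeros ψ).ncard : ℕ) : ℝ)] with k hk
  exact le_trans (by exact_mod_cast ncard_compl_admissible_le hψ k) hk

section Convergence

theorem abs_pressure_sub_pressure_univ_le {n M : ℕ} {A : Set (Word n)} {X : Set Seq}
    {g : Seq → ℝ} {C D : ℝ} (hX : IsTransitivePiece A X)
    (hdim : upperBoxDim X = upperBoxDim (sft A)) (hM : 0 < M) (hMn : 2 * M ≤ n)
    (hg : IsBowen g C D)
    (hcard : 2 * ((safeWords A M)ᶜ.ncard : ℝ) < (1 + Real.exp (-(D + 2 * C))) ^ M) :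
    |pressure X g - pressure univ g| ≤ (4 * D + Real.log 2) / M := by
  classical
  obtain ⟨u, hu, rfl⟩ := isTransitivePiece_iff.1 hX
  obtain ⟨R, hR⟩ := exists_isTransitiveMarkov_piece (by omega) hu
  have hexp : Real.exp (-(D + 2 * C)) ≤ 1 :=
    Real.exp_le_one_iff.2 (by linarith [hg.bound_nonneg, hg.distortion_nonneg])
  have hcard_two : 2 * (safeWords A M)ᶜ.ncard < 2 ^ M := by
    have : 2 * ((safeWords A M)ᶜ.ncard : ℝ) < 2 ^ M :=
      hcard.trans_le (pow_le_pow_left₀ (by positivity) (by linarith) M)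
    exact_mod_cast this
  obtain ⟨x, hx, hx0⟩ := exists_pref_mem_safeWords hM hMn hu hdim hcard_two
  have hfree := freeShift_safeWords_subset_piece hM hMn hx hx0
  obtain ⟨W, hW⟩ := (toFinite (safeWords A M)).exists_finset_coe
  rw [← hW, ← Finset.coe_compl, ncard_coe_finset] at hcard
  have hlower := hR.mul_pressure_univ_le hg (W := W) (by rwa [hW]) hcard.le
  have hupper := hR.pressure_le_pressure_univ hg
  rw [abs_of_nonpos (by linarith), le_div_iff₀ (by exact_mod_cast hM)]
  linarith

theorem eventually_mul_add_one_lt_pow (a : ℝ) {r : ℝ} (hr : 1 < r) :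
    ∀ᶠ k : ℕ in atTop, a * (k + 1) < r ^ k := by
  have hlim : Tendsto (fun k : ℕ => a * r * (((k + 1 : ℕ) : ℝ) ^ 1 / r ^ (k + 1))) atTop
      (𝓝 (a * r * 0)) :=
    ((tendsto_add_atTop_iff_nat 1).2
      (tendsto_pow_const_div_const_pow_of_one_lt 1 hr)).const_mul _
  rw [mul_zero] at hlim
  filter_upwards [hlim.eventually (gt_mem_nhds one_pos)] with k hk
  have hrk : 0 < r ^ k := by positivity
  rw [← div_lt_one hrk]
  convert hk using 1
  push_cast
  field_simp
  ring

variable {A : ∀ k, Set (Word k)}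

/-- `A k` excludes subexponentially many words, and each of them spoils at most `k + 1` words of
length `k / 2`. -/
theorem eventually_two_mul_ncard_compl_safeWords_lt
    (hA : ∀ r > 1, ∀ᶠ k in atTop, ((A k)ᶜ.ncard : ℝ) ≤ r ^ k) {ρ : ℝ} (hρ : 1 < ρ) :
    ∀ᶠ k in atTop, 2 * ((safeWords (A k) (k / 2))ᶜ.ncard : ℝ) < ρ ^ (k / 2) := by
  obtain ⟨r, hr, rfl⟩ : ∃ r > 1, r ^ 4 = ρ :=
    ⟨ρ ^ ((4 : ℕ) : ℝ)⁻¹, Real.one_lt_rpow hρ (by positivity),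
      Real.rpow_inv_natCast_pow (by positivity) four_ne_zero⟩
  filter_upwards [hA r hr, eventually_mul_add_one_lt_pow (2 * r ^ 2) hr] with k hAk hk
  have hcard : ((safeWords (A k) (k / 2))ᶜ.ncard : ℝ) ≤ (A k)ᶜ.ncard * (k + 1) := by
    exact_mod_cast ncard_compl_safeWords_le (A k) (k / 2)
  refine lt_of_mul_lt_mul_left ?_ (by positivity : 0 ≤ r ^ 2)
  calc r ^ 2 * (2 * ((safeWords (A k) (k / 2))ᶜ.ncard : ℝ))
      ≤ r ^ 2 * (2 * (r ^ k * (k + 1))) := by gcongr; exact hcard.trans (by gcongr)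
    _ = r ^ k * (2 * r ^ 2 * (k + 1)) := by ring
    _ < r ^ k * r ^ k := by gcongr
    _ = r ^ (k + k) := (pow_add r k k).symm
    _ ≤ r ^ (2 + 4 * (k / 2)) := pow_le_pow_right₀ hr.le (by omega)
    _ = r ^ 2 * (r ^ 4) ^ (k / 2) := by rw [pow_add, pow_mul]

variable {X : ℕ → Set Seq} {φ : Seq → ℝ} {C D : ℝ}

theorem eventually_abs_pressure_sub_le
    (hA : ∀ r > 1, ∀ᶠ k in atTop, ((A k)ᶜ.ncard : ℝ) ≤ r ^ k)
    (hX : ∀ᶠ k in atTop, IsTransitivePiece (A k) (X k) ∧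
      upperBoxDim (X k) = upperBoxDim (sft (A k)))
    (hφ : IsBowen φ C D) (Q : ℝ) {ε : ℝ} (hε : 0 < ε) :
    ∀ᶠ k in atTop, ∀ q : ℝ, |q| ≤ Q →
      |pressure (X k) (fun t => q * φ t) - pressure univ (fun t => q * φ t)| < ε := by
  have hhalf : Tendsto (fun k : ℕ => k / 2) atTop atTop := Nat.tendsto_div_const_atTop two_ne_zero
  have herror : Tendsto (fun k : ℕ => (4 * (Q * D) + Real.log 2) / (k / 2 : ℕ)) atTop (𝓝 0) :=
    (tendsto_const_div_atTop_nhds_zero_nat _).comp hhalf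
  have hρ : 1 < 1 + Real.exp (-(Q * D + 2 * (Q * C))) := lt_add_of_pos_right 1 (Real.exp_pos _)
  filter_upwards [hX, eventually_two_mul_ncard_compl_safeWords_lt hA hρ,
    herror.eventually (gt_mem_nhds hε), hhalf.eventually_gt_atTop 0] with
    k ⟨hpiece, hdim⟩ hcard hk hpos q hq
  exact (abs_pressure_sub_pressure_univ_le hpiece hdim hpos (by omega)
    (hφ.const_mul_of_abs_le hq) hcard).trans_lt hk

theorem tendstoLocallyUniformly_pressure
    (hA : ∀ r > 1, ∀ᶠ k in atTop, ((A k)ᶜ.ncard : ℝ) ≤ r ^ k)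
    (hX : ∀ᶠ k in atTop, IsTransitivePiece (A k) (X k) ∧
      upperBoxDim (X k) = upperBoxDim (sft (A k)))
    (hφ : IsBowen φ C D) :
    TendstoLocallyUniformly (fun k (q : ℝ) => pressure (X k) fun t => q * φ t)
      (fun q => pressure univ fun t => q * φ t) atTop := by
  refine Metric.tendstoLocallyUniformly_iff.2 fun ε hε q₀ =>
    ⟨_, Metric.ball_mem_nhds q₀ one_pos, ?_⟩
  filter_upwards [eventually_abs_pressure_sub_le hA hX hφ (|q₀| + 1) hε] with k hk q hq
  rw [dist_comm, Real.dist_eq]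
  rw [Metric.mem_ball, Real.dist_eq] at hq
  exact hk q (by linarith [abs_sub_abs_le_abs_sub q q₀])

end Convergence

/-! ### Derivatives of convex functions -/

section Convex

variable {f F : ℝ → ℝ}

theorem deriv_mul_le_sub_of_convexOn (hf : ConvexOn ℝ univ f) (hd : Differentiable ℝ f)
    (x h : ℝ) : deriv f x * h ≤ f (x + h) - f x := by
  rcases lt_trichotomy h 0 with hh | rfl | hh
  · have hslope := hf.slope_le_deriv (mem_univ (x + h)) (mem_univ x) (by linarith) (hd x)
    rw [slope_def_field, div_le_iff₀ (by linarith)] at hslope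
    linarith
  · simp
  · have hslope := hf.deriv_le_slope (mem_univ x) (mem_univ (x + h)) (by linarith) (hd x)
    rwa [slope_def_field, le_div_iff₀ (by linarith), add_sub_cancel_left] at hslope

/-- The derivative is monotone, and by Darboux's theorem its range has no gaps. -/
theorem continuous_deriv_of_convexOn (hf : ConvexOn ℝ univ f) (hd : Differentiable ℝ f) :
    Continuous (deriv f) := by
  have hmono : Monotone (deriv f) := monotoneOn_univ.1 (hf.monotoneOn_deriv fun x _ => hd x)
  have hrange : OrdConnected (range (deriv f)) := by
    rw [← image_univ]
    exact ordConnected_univ.image_deriv fun x _ => hd x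
  exact continuous_subtype_val.comp
    (hmono.rangeFactorization.continuous_of_surjective rangeFactorization_surjective)

theorem deriv_mul_le_deriv_add_mul_add {η x h : ℝ} (hF : ConvexOn ℝ univ F)
    (hFd : Differentiable ℝ F) (hf : ConvexOn ℝ univ f) (hfd : Differentiable ℝ f)
    (hx : |f x - F x| ≤ η) (hxh : |f (x + h) - F (x + h)| ≤ η) :
    deriv F x * h ≤ deriv f (x + h) * h + 2 * η := by
  have hFx := deriv_mul_le_sub_of_convexOn hF hFd x h
  have hfx := deriv_mul_le_sub_of_convexOn hf hfd (x + h) (-h)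
  rw [add_neg_cancel_right] at hfx
  linarith [(abs_le.1 hx).2, (abs_le.1 hxh).1]

theorem abs_deriv_sub_deriv_le {η δ ε x : ℝ} (hF : ConvexOn ℝ univ F) (hFd : Differentiable ℝ F)
    (hf : ConvexOn ℝ univ f) (hfd : Differentiable ℝ f) (hδ : 0 < δ)
    (hclose : ∀ h, |h| ≤ δ → |f (x + h) - F (x + h)| ≤ η)
    (hosc : ∀ h, |h| ≤ δ → |deriv f (x + h) - deriv f x| ≤ ε) :
    |deriv f x - deriv F x| ≤ ε + 2 * η / δ := by
  have hx := hclose 0 (by rw [abs_zero]; exact hδ.le)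
  rw [add_zero] at hx
  have hright : |δ| ≤ δ := (abs_of_pos hδ).le
  have hleft : |-δ| ≤ δ := (abs_neg δ).trans_le hright
  have hupper : deriv F x ≤ deriv f (x + δ) + 2 * η / δ := by
    rw [← sub_le_iff_le_add', le_div_iff₀ hδ]
    linarith [deriv_mul_le_deriv_add_mul_add hF hFd hf hfd hx (hclose δ hright)]
  have hlower : deriv f (x + -δ) - deriv F x ≤ 2 * η / δ := by
    rw [le_div_iff₀ hδ]
    linarith [deriv_mul_le_deriv_add_mul_add hF hFd hf hfd hx (hclose (-δ) hleft)]
  rw [abs_le]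
  constructor <;> linarith [(abs_le.1 (hosc δ hright)).2, (abs_le.1 (hosc (-δ) hleft)).1]

theorem tendstoLocallyUniformly_deriv_of_convexOn {ι : Type*} {p : Filter ι} {F : ι → ℝ → ℝ}
    (hF : ∀ᶠ i in p, ConvexOn ℝ univ (F i) ∧ Differentiable ℝ (F i))
    (hf : ConvexOn ℝ univ f) (hfd : Differentiable ℝ f) (hFf : TendstoLocallyUniformly F f p) :
    TendstoLocallyUniformly (fun i => deriv (F i)) (deriv f) p := by
  refine Metric.tendstoLocallyUniformly_iff.2 fun ε hε x => ?_
  obtain ⟨δ, hδ, hcont⟩ := Metric.continuous_iff.1 (continuous_deriv_of_convexOn hf hfd) x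
    (ε / 4) (by positivity)
  have hunif := Metric.tendstoUniformlyOn_iff.1
    (tendstoLocallyUniformly_iff_forall_isCompact.1 hFf _ (isCompact_closedBall x δ))
    (ε * δ / 16) (by positivity)
  refine ⟨_, Metric.ball_mem_nhds x (half_pos hδ), ?_⟩
  filter_upwards [hF, hunif] with i ⟨hFi, hFid⟩ hi y hy
  have hball : ∀ h, |h| ≤ δ / 2 → dist (y + h) x < δ := fun h hh => by
    rw [Metric.mem_ball, Real.dist_eq] at hy
    rw [Real.dist_eq, add_sub_right_comm]
    linarith [abs_add_le (y - x) h]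
  have hosc : ∀ h, |h| ≤ δ / 2 → |deriv f (y + h) - deriv f y| ≤ ε / 2 := fun h hh => by
    have hyx := hcont y ((Metric.mem_ball.1 hy).trans (half_lt_self hδ))
    have := dist_triangle_right (deriv f (y + h)) (deriv f y) (deriv f x)
    rw [← Real.dist_eq]
    linarith [hcont _ (hball h hh)]
  calc dist (deriv f y) (deriv (F i) y)
      ≤ ε / 2 + 2 * (ε * δ / 16) / (δ / 2) :=
        abs_deriv_sub_deriv_le hFi hFid hf hfd (half_pos hδ)
          (fun h hh => (hi _ (Metric.ball_subset_closedBall (hball h hh))).le) hosc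
    _ = 3 / 4 * ε := by field_simp; norm_num
    _ < ε := by linarith

end Convex

theorem mainTheorem3_general {A : ∀ k, Set (Word k)}
    (hA : ∀ r > 1, ∀ᶠ k in atTop, ((A k)ᶜ.ncard : ℝ) ≤ r ^ k)
    {φ : Seq → ℝ} {C D : ℝ} (hφ : IsBowen φ C D)
    {k₀ : ℕ} (hk₀ : 1 ≤ k₀) {X : ℕ → Set Seq}
    (hX : ∀ k, k₀ ≤ k → IsTransitivePiece (A k) (X k) ∧
      upperBoxDim (X k) = upperBoxDim (sft (A k))) :
    (∀ q : ℝ, Tendsto (pressureSeq univ (fun t => q * φ t)) atTop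
      (𝓝 (pressure univ (fun t => q * φ t)))) ∧
    (∀ k, k₀ ≤ k → ∀ q : ℝ, Tendsto (pressureSeq (X k) (fun t => q * φ t)) atTop
      (𝓝 (pressure (X k) (fun t => q * φ t)))) ∧
    Differentiable ℝ (fun q : ℝ => pressure univ (fun t => q * φ t)) ∧
    (∀ k, k₀ ≤ k → Differentiable ℝ (fun q : ℝ => pressure (X k) (fun t => q * φ t))) ∧
    (∀ q : ℝ, Tendsto (fun k => pressure (X k) (fun t => q * φ t)) atTop
      (𝓝 (pressure univ (fun t => q * φ t)))) ∧
    (∀ a b : ℝ,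
      TendstoUniformlyOn (fun (k : ℕ) (q : ℝ) => pressure (X k) (fun t => q * φ t))
        (fun q : ℝ => pressure univ (fun t => q * φ t)) atTop (Icc a b) ∧
      TendstoUniformlyOn
        (fun (k : ℕ) (q : ℝ) => deriv (fun q' : ℝ => pressure (X k) (fun t => q' * φ t)) q)
        (fun q : ℝ => deriv (fun q' : ℝ => pressure univ (fun t => q' * φ t)) q)
        atTop (Icc a b)) := by
  have hmarkov : ∀ k, k₀ ≤ k → ∃ R, IsTransitiveMarkov (k - 1) R (X k) := fun k hk => by
    obtain ⟨u, hu, hXk⟩ := isTransitivePiece_iff.1 (hX k hk).1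
    exact hXk ▸ exists_isTransitiveMarkov_piece (hk₀.trans hk) hu
  choose! R hR using hmarkov
  have hlim := tendstoLocallyUniformly_pressure hA (eventually_atTop.2 ⟨k₀, hX⟩) hφ
  have hderiv := tendstoLocallyUniformly_deriv_of_convexOn
    (eventually_atTop.2 ⟨k₀, fun k hk =>
      ⟨(hR k hk).convexOn_pressure hφ, (hR k hk).differentiable_pressure hφ⟩⟩)
    (isTransitiveMarkov_univ.convexOn_pressure hφ)
    (isTransitiveMarkov_univ.differentiable_pressure hφ) hlim
  have hcompact {F : ℕ → ℝ → ℝ} {f : ℝ → ℝ} (h : TendstoLocallyUniformly F f atTop) (a b : ℝ) :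
      TendstoUniformlyOn F f atTop (Icc a b) :=
    tendstoLocallyUniformly_iff_forall_isCompact.1 h _ isCompact_Icc
  exact ⟨fun q => isTransitiveMarkov_univ.tendsto_pressureSeq (hφ.const_mul q),
    fun k hk q => (hR k hk).tendsto_pressureSeq (hφ.const_mul q),
    isTransitiveMarkov_univ.differentiable_pressure hφ,
    fun k hk => (hR k hk).differentiable_pressure hφ,
    fun q => (hcompact hlim q q).tendsto_at (left_mem_Icc.2 le_rfl),
    fun a b => ⟨hcompact hlim a b, hcompact hderiv a b⟩⟩

end WaveletShift

open WaveletShift in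
theorem mainTheorem3 (ψ : ℝ → ℝ) (hψ : (zeros ψ).Finite)
    (φ : Seq → ℝ) (hφ : ∃ C r : ℝ≥0, 0 < r ∧ HolderWith C r φ)
    (k₀ : ℕ) (hk₀ : 2 ≤ k₀) (X : ℕ → Set Seq)
    (hX : ∀ k, k₀ ≤ k → IsZeroAvoidingPiece ψ k (X k)) :
    -- the limits defining the pressures exist
    (∀ q : ℝ, Tendsto (pressureSeq univ (fun t => q * φ t)) atTop
      (𝓝 (pressure univ (fun t => q * φ t)))) ∧
    (∀ k, k₀ ≤ k → ∀ q : ℝ, Tendsto (pressureSeq (X k) (fun t => q * φ t)) atTop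
      (𝓝 (pressure (X k) (fun t => q * φ t)))) ∧
    -- the pressures are differentiable functions of `q`
    Differentiable ℝ (fun q : ℝ => pressure univ (fun t => q * φ t)) ∧
    (∀ k, k₀ ≤ k → Differentiable ℝ (fun q : ℝ => pressure (X k) (fun t => q * φ t))) ∧
    -- pointwise convergence of the pressures
    (∀ q : ℝ, Tendsto (fun k => pressure (X k) (fun t => q * φ t)) atTop
      (𝓝 (pressure univ (fun t => q * φ t)))) ∧
    -- uniform convergence on compact intervals of the pressures and of their derivatives
    (∀ a b : ℝ,
      TendstoUniformlyOn (fun (k : ℕ) (q : ℝ) => pressure (X k) (fun t => q * φ t))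
        (fun q : ℝ => pressure univ (fun t => q * φ t)) atTop (Icc a b) ∧
      TendstoUniformlyOn
        (fun (k : ℕ) (q : ℝ) => deriv (fun q' : ℝ => pressure (X k) (fun t => q' * φ t)) q)
        (fun q : ℝ => deriv (fun q' : ℝ => pressure univ (fun t => q' * φ t)) q)
        atTop (Icc a b)) := by
  obtain ⟨_, _, hr, hH⟩ := hφ
  obtain ⟨_, _, hB⟩ := exists_isBowen_of_holderWith hr hH
  exact mainTheorem3_general (fun _ hr => eventually_ncard_compl_admissible_le hψ hr) hB
    (by omega) hX
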